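/- For $\Re z>0$ let $\theta(z)=\sum_{n\in\mathbf Z}e^{-\pi n^2z}$, and for $s\in\mathbf C\setminus\{0\}$ let $$\Lambda(s)=-\frac1s+\int_1^\infty x^{s/2}\,\frac{\theta(x)-1}{2}\,\frac{dx}{x};$$ $s\Lambda(s)$ extends to an entire function with value $-1$ at $s=0$. Let $Z(t)=e^{i\vartheta(t)}\zeta(\tfrac12+it)$ be the Riemann–Siegel function, where $\pi^{-s/2}\Gamma(s/2)=|\pi^{-s/2}\Gamma(s/2)|\,e^{i\vartheta(t)}$ for $s=\tfrac12+it$, $t\in\mathbf R$. The zeros of the entire function $s\Lambda(s)$, repeated according to multiplicity, can be enumerated as $(b_n)_{n\in\mathbf Z}$ with $b_0$ real, $b_n$ not real for $n\ne0$, $b_{-n}=\overline{b_n}$, and $|b_n|\le|b_{n+1}|$ for $n\ge1$. For the real constant $\alpha=\int_1^\infty\frac{\theta(x)-1}{2}\frac{dx}{x}$ and every such enumeration, $$\Lambda(s)=-\frac{e^{-\alpha s}}{s}\prod_{n\in\mathbf Z}\Bigl(1-\frac{s}{b_n}\Bigr)e^{s/b_n}\qquad(s\ne0),$$ with an unconditionally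 convergent product. The function $\Lambda$ does not vanish on the line $\Re s=\tfrac12$; there is a continuous determination of $\arg\Lambda(\tfrac12+it)$, $t\in\mathbf R$, with $|\arg\Lambda(\tfrac12+it)-\tfrac\pi2|<0.19$ for all $t>10$; and there is a real function $u(t)$ with $u(t)>0$ for $t>0$, such that for every such enumeration and all real $t$, with $s=\tfrac12+it$, $$Z(t)=u(t)\Bigl\{-\frac\pi2+\alpha t+\arctan 2t-\sum_{n\in\mathbf Z}\Bigl[\arg\Bigl(1-\frac{s}{b_n}\Bigr)+\Im\frac{s}{b_n}\Bigr]\Bigr\}.$$ Here no $1-s/b_n$ lies in $(-\infty,0]$, $\arg(1-s/b_n)\in(-\pi,\pi)$ is the principal value, and the series converges absolutely. Moreover, the expression in braces equals $\frac\pi2-\arg\Lambda(\tfrac12+it)$ for all real $t$. -/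

import Mathlib

namespace RiemannSiegelExpr

noncomputable section

/-- The theta function `θ(z) = ∑_{n ∈ ℤ} exp (-π n² z)`, for `Re z > 0`, written through Mathlib's
`jacobiTheta τ = ∑_{n ∈ ℤ} exp (π i n² τ)`. -/
def theta (z : ℂ) : ℂ := jacobiTheta (Complex.I * z)

/-- The entire function `s ↦ ∫_1^∞ x^{s/2} (θ(x) - 1)/2 dx/x`. -/
def thetaIntegral (s : ℂ) : ℂ :=
  ∫ x in Set.Ioi (1 : ℝ), (x : ℂ) ^ (s / 2) * ((theta (x : ℂ) - 1) / 2) / (x : ℂ)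

/-- The meromorphic function `Λ(s) = π^{-s/2} Γ(s/2) 𝓛(s)`
`= -1/s + ∫_1^∞ x^{s/2} (θ(x) - 1)/2 dx/x`, for `s ≠ 0`. -/
def Lam (s : ℂ) : ℂ := -1 / s + thetaIntegral s

/-- The entire function `s Λ(s)`, with its correct value `-1` at the removable point `s = 0`. -/
def sLam (s : ℂ) : ℂ := -1 + s * thetaIntegral s

theorem sLam_eq {s : ℂ} (hs : s ≠ 0) : sLam s = s * Lam s := by
  unfold sLam Lam
  field_simp

theorem sLam_zero : sLam 0 = -1 := by
  simp [sLam]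

/-- `b : ℤ → ℂ` enumerates the zeros of `s Λ(s)`, each repeated according to its multiplicity, in
the following way: `b 0` is real and all other `b n` are not, `b (-n)` is the conjugate of `b n`,
and `|b n| ≤ |b (n + 1)|` for `n ≥ 1`. -/
structure IsZeroEnumeration (b : ℤ → ℂ) : Prop where
  multiplicity : ∀ z : ℂ, {n : ℤ | b n = z}.encard = analyticOrderAt sLam z
  real_iff : ∀ n : ℤ, (b n).im = 0 ↔ n = 0
  conj : ∀ n : ℤ, b (-n) = (starRingEnd ℂ) (b n)
  ordered : ∀ n : ℤ, 1 ≤ n → ‖b n‖ ≤ ‖b (n + 1)‖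

/-- The point `1/2 + it` of the critical line. -/
def crit (t : ℝ) : ℂ := 1 / 2 + (t : ℂ) * Complex.I

/-- The Riemann-Siegel function `Z(t) = e^{iϑ(t)} ζ(1/2 + it)`, as a complex number. By the
definition of `ϑ`, `π^{-s/2} Γ(s/2) = |π^{-s/2} Γ(s/2)| e^{iϑ(t)}` for `s = 1/2 + it`; recall that
`Complex.Gammaℝ s = π^{-s/2} Γ(s/2)`. -/
def Z (t : ℝ) : ℂ :=
  Complex.Gammaℝ (crit t) / (‖Complex.Gammaℝ (crit t)‖ : ℂ) * riemannZeta (crit t)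

/-- `φ(t)` is the continuous determination of `arg Λ(1/2 + it)` that is close to `π/2` for large
positive `t`. -/
structure IsArgLam (φ : ℝ → ℝ) : Prop where
  continuous : Continuous φ
  ne_zero : ∀ t : ℝ, Lam (crit t) ≠ 0
  polar : ∀ t : ℝ, Lam (crit t) = (‖Lam (crit t)‖ : ℂ) * Complex.exp ((φ t : ℂ) * Complex.I)
  near : ∀ t : ℝ, 10 < t → |φ t - Real.pi / 2| < 0.19

/-- The general term `arg (1 - s/b_n) + Im (s/b_n)` of the series, with `s = 1/2 + it` and the
principal value of the argument. -/
def argTerm (b : ℤ → ℂ) (t : ℝ) (n : ℤ) : ℝ :=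
  Complex.arg (1 - crit t / b n) + (crit t / b n).im

/-- `-π/2 + α t + arctan 2t - ∑_{n ∈ ℤ} (arg (1 - s/b_n) + Im (s/b_n))`, `s = 1/2 + it`. -/
def bracket (α : ℝ) (b : ℤ → ℂ) (t : ℝ) : ℝ :=
  -(Real.pi / 2) + α * t + Real.arctan (2 * t) - ∑' n : ℤ, argTerm b t n

end

end RiemannSiegelExpr

/-! The functional equation of `θ` folds the Mellin integral of the completed zeta function onto
`(1, ∞)` and writes that function as `Λ(s) + Λ(1 - s)` (`completedRiemannZeta_eq_Lam`). On the
critical line `1 - s` is the conjugate of `s`, and `Λ` commutes with conjugation, so `Z(t) = 2 Re Λ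
/ |Gammaℝ|` (`Z_eq`). With `φ = arg Λ` one has `Re Λ = |Λ| sin (π/2 - φ) = |Λ| sinc (π/2 - φ) (π/2 -
φ)`. This exhibits `u`, which is positive as soon as `|π/2 - φ| < π`. For `t > 0` even `0 < φ < π`:
integration by parts in each term of the theta series gives `Im Λ > 0` (`Lam_im_pos`). The same
sign, with a direct estimate on the real axis, keeps every zero of `sΛ(s)` in `Re s > 1`
(`sLam_ne_zero`).

It remains to recognise `π/2 - φ` as the bracket. The function `sΛ(s)` has growth `exp
(O(R^{3/2}))`; counting zeros in discs gives `∑ |b_n|⁻² < ∞`, and Hadamard factorization in genus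
one yields the product (`hasProd_genus_one`). The derivative at `0` supplies the factor `e^{-αs}`.
Since `Re b_n > 1 > Re s`, no `s / b_n` is real and `≥ 1`, so principal logarithms may be summed,
and the bracket equals `π/2 - φ` modulo `2π` (`exp_bracket`). Both are continuous and equal `-π/2`
at `t = 0`, hence they agree.

An enumeration of the required shape exists because `σ ↦ σ thetaIntegral σ` has positive derivative
for `σ > 1`, so there is exactly one real zero and it is simple, while the other zeros form
infinitely many conjugate pairs. Finitely many zeros would bound `sΛ(s)` by a simple exponential,
which `exists_exp_lt_sLam` excludes. -/

namespace RiemannSiegelExpr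

open Filter Topology Metric Set MeasureTheory

/-! ### Hadamard factorization in genus one. -/

section Hadamard

theorem analyticOrderAt_one_sub_div {b : ℂ} (hb : b ≠ 0) (z : ℂ) :
    analyticOrderAt (fun s : ℂ => 1 - s / b) z = if b = z then 1 else 0 := by
  split_ifs with h
  · subst h
    have : (fun s : ℂ => 1 - s / b) = (fun _ : ℂ => -b⁻¹) * (fun s : ℂ => s - b) := by
      ext s
      simp only [Pi.mul_apply]
      field_simp
      ring
    rw [this, analyticOrderAt_mul (by fun_prop) (by fun_prop), analyticOrderAt_id_sub_const_self,
      analyticOrderAt_eq_zero.2 (Or.inr (by simpa using hb)), zero_add]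
  · refine analyticOrderAt_eq_zero.2 (Or.inr ?_)
    rw [sub_ne_zero, ne_comm, Ne, div_eq_one_iff_eq hb]
    exact fun h' => h h'.symm

theorem analyticOrderAt_prod_one_sub_div {ι : Type*} {b : ι → ℂ} (hb : ∀ i, b i ≠ 0)
    (T : Finset ι) (z : ℂ) :
    analyticOrderAt (fun s : ℂ => ∏ i ∈ T, (1 - s / b i)) z
      = ((T.filter (fun i => b i = z)).card : ℕ∞) := by
  classical
  induction T using Finset.induction_on with
  | empty => simp [analyticOrderAt_eq_zero]
  | insert a T ha ih =>
    have : (fun s : ℂ => ∏ i ∈ insert a T, (1 - s / b i))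
        = (fun s : ℂ => 1 - s / b a) * (fun s : ℂ => ∏ i ∈ T, (1 - s / b i)) := by
      ext s
      simp [Finset.prod_insert ha]
    rw [this, analyticOrderAt_mul (by fun_prop) (by fun_prop), ih,
      analyticOrderAt_one_sub_div (hb a), Finset.filter_insert]
    split_ifs with h
    · rw [Finset.card_insert_of_notMem (by simp [ha]), add_comm]
      push_cast
      rfl
    · simp

/-- Finitely many zeros of an entire function can be divided out. -/
theorem exists_eq_prod_mul {ι : Type*} {f : ℂ → ℂ} (hf : Differentiable ℂ f) {b : ι → ℂ}
    (hb : ∀ i, b i ≠ 0) (T : Finset ι)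
    (hT : ∀ z, ((T.filter (fun i => b i = z)).card : ℕ∞) ≤ analyticOrderAt f z) :
    ∃ F : ℂ → ℂ, Differentiable ℂ F ∧ f = (fun s => ∏ i ∈ T, (1 - s / b i)) * F := by
  classical
  induction T using Finset.induction_on with
  | empty => exact ⟨f, hf, by ext; simp⟩
  | insert a T ha ih =>
    obtain ⟨F, hF, hfF⟩ := ih fun z => le_trans (by
      gcongr
      exact Finset.subset_insert a T) (hT z)
    -- Counted over `insert a T`, the point `b a` occurs once more than over `T`; the extra
    -- multiplicity must come from `F`.
    have hFa : F (b a) = 0 := by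
      have h1 := hT (b a)
      rw [hfF, analyticOrderAt_mul (by fun_prop) (hF.analyticAt _),
        analyticOrderAt_prod_one_sub_div hb, Finset.filter_insert, if_pos rfl,
        Finset.card_insert_of_notMem (by simp [ha])] at h1
      push_cast at h1
      have h2 : (1 : ℕ∞) ≤ analyticOrderAt F (b a) :=
        (ENat.add_le_add_iff_left (ENat.natCast_ne_top _)).1 h1
      exact (analyticOrderAt_ne_zero.1 (by
        intro h
        rw [h] at h2
        simp at h2)).2
    refine ⟨fun s => -b a * dslope F (b a) s, ?_, ?_⟩
    · have : Differentiable ℂ (dslope F (b a)) := by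
        rw [← differentiableOn_univ] at hF ⊢
        exact (Complex.differentiableOn_dslope univ_mem).2 hF
      fun_prop
    · rw [hfF]
      ext s
      have := sub_smul_dslope F (b a) s
      rw [hFa, sub_zero, smul_eq_mul] at this
      simp only [Pi.mul_apply, Finset.prod_insert ha, ← this]
      have := hb a
      field_simp
      ring

theorem card_filter_le_analyticOrderAt {ι : Type*} {f : ℂ → ℂ} {b : ι → ℂ}
    (hb : ∀ z, {i | b i = z}.encard = analyticOrderAt f z) (T : Finset ι) (z : ℂ) :
    ((T.filter (fun i => b i = z)).card : ℕ∞) ≤ analyticOrderAt f z := by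
  rw [← hb, ← Set.encard_coe_eq_coe_finsetCard]
  exact Set.encard_le_encard fun i hi => by simpa using (Finset.mem_filter.1 hi).2

theorem ne_zero_of_encard_eq {ι : Type*} {f : ℂ → ℂ} {b : ι → ℂ} (h0 : f 0 ≠ 0)
    (hb : ∀ z, {i | b i = z}.encard = analyticOrderAt f z) (i : ι) : b i ≠ 0 := by
  intro h
  have h1 := hb 0
  rw [analyticOrderAt_eq_zero.2 (Or.inr h0), Set.encard_eq_zero] at h1
  exact (h1 ▸ h : i ∈ (∅ : Set ι))

theorem norm_le_of_sphere {F : ℂ → ℂ} (hF : Differentiable ℂ F) {R C : ℝ} (hR : 0 < R)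
    (hC : ∀ s, ‖s‖ = R → ‖F s‖ ≤ C) {s : ℂ} (hs : ‖s‖ ≤ R) : ‖F s‖ ≤ C := by
  refine Complex.norm_le_of_forall_mem_frontier_norm_le (U := ball (0 : ℂ) R) isBounded_ball
    hF.diffContOnCl (fun z hz => hC z ?_) ?_
  · simpa [frontier_ball (0 : ℂ) hR.ne'] using hz
  · simpa [closure_ball (0 : ℂ) hR.ne'] using hs

theorem le_norm_one_sub_div {s b : ℂ} {k R : ℝ} (hb : b ≠ 0) (hbR : ‖b‖ ≤ R)
    (hs : ‖s‖ = (k + 1) * R) (hk : 0 ≤ k) : k ≤ ‖1 - s / b‖ := by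
  have hb' : 0 < ‖b‖ := norm_pos_iff.2 hb
  have h1 : k + 1 ≤ ‖s / b‖ := by
    rw [norm_div, hs, le_div_iff₀ hb']
    gcongr
  have h2 := norm_sub_norm_le (s / b) 1
  rw [norm_one, norm_sub_rev] at h2
  linarith

/-- A bound for the number of zeros of an entire function in a disc. -/
theorem two_pow_card_le {ι : Type*} {f : ℂ → ℂ} (hf : Differentiable ℂ f) (h0 : f 0 = 1)
    {b : ι → ℂ} (hb : ∀ z, {i | b i = z}.encard = analyticOrderAt f z) {R C : ℝ} (hR : 0 < R)
    (hC : ∀ s, ‖s‖ = 3 * R → ‖f s‖ ≤ C) (T : Finset ι) (hT : ∀ i ∈ T, ‖b i‖ ≤ R) :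
    (2 : ℝ) ^ T.card ≤ C := by
  have hb0 := ne_zero_of_encard_eq (by simp [h0]) hb
  obtain ⟨F, hF, hfF⟩ := exists_eq_prod_mul hf hb0 T (card_filter_le_analyticOrderAt hb T)
  have hF0 : F 0 = 1 := by
    have := congrFun hfF 0
    simpa [h0] using this.symm
  -- On `‖s‖ = 3R` each factor `1 - s / b i` has modulus at least 2, so dividing them out gains `2 ^
  -- T.card`; the maximum principle carries the gain to the centre, where `F 0 = 1`.
  have key := norm_le_of_sphere hF (R := 3 * R) (C := C / 2 ^ T.card) (by positivity)
    (fun s hs => ?_) (s := 0) (by simp; positivity)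
  · rw [hF0, norm_one, le_div_iff₀ (by positivity)] at key
    linarith
  · rw [le_div_iff₀ (by positivity)]
    have h1 : (2 : ℝ) ^ T.card ≤ ‖∏ i ∈ T, (1 - s / b i)‖ := by
      rw [norm_prod, ← Finset.prod_const]
      exact Finset.prod_le_prod (by simp) fun i hi =>
        le_norm_one_sub_div (hb0 i) (hT i hi) (by rw [hs]; ring) (by norm_num)
    have h2 : ‖f s‖ = ‖∏ i ∈ T, (1 - s / b i)‖ * ‖F s‖ := by
      rw [hfF, Pi.mul_apply, norm_mul]
    calc ‖F s‖ * 2 ^ T.card ≤ ‖F s‖ * ‖∏ i ∈ T, (1 - s / b i)‖ := by gcongr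
      _ = ‖f s‖ := by rw [h2, mul_comm]
      _ ≤ C := hC s hs

/-- A primitive `h` of `F' / F` exists on the disc, and `F exp (-h)` has zero derivative there. -/
theorem exists_exp_eq {F : ℂ → ℂ} (hF : Differentiable ℂ F) {R : ℝ} (h0 : F 0 = 1)
    (hne : ∀ z ∈ ball (0 : ℂ) R, F z ≠ 0) (hR : 0 < R) :
    ∃ h : ℂ → ℂ, h 0 = 0 ∧ DifferentiableOn ℂ h (ball 0 R) ∧ deriv h 0 = deriv F 0 ∧
      ∀ z ∈ ball (0 : ℂ) R, F z = Complex.exp (h z) := by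
  have hd : DifferentiableOn ℂ (fun z => deriv F z / F z) (ball 0 R) :=
    hF.deriv.differentiableOn.div hF.differentiableOn hne
  obtain ⟨h, h1, h2⟩ := hd.isExactOn_ball.with_val_at 0 0
  have hmem : (0 : ℂ) ∈ ball (0 : ℂ) R := by simpa using hR
  refine ⟨h, h1, fun z hz => (h2 z hz).differentiableAt.differentiableWithinAt, ?_, ?_⟩
  · rw [(h2 0 hmem).deriv, h0, div_one]
  · intro z hz
    have hder : ∀ w ∈ ball (0 : ℂ) R,
        HasDerivAt (fun w => F w * Complex.exp (-h w)) 0 w := by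
      intro w hw
      have := (hF w).hasDerivAt.mul ((h2 w hw).neg.cexp)
      refine this.congr_deriv ?_
      have := hne w hw
      field_simp
      ring
    have hc := (convex_ball (0 : ℂ) R).is_const_of_fderivWithin_eq_zero (𝕜 := ℂ)
      (fun w hw => (hder w hw).differentiableAt.differentiableWithinAt) (fun w hw => ?_) hz hmem
    · simp only [h0, h1, neg_zero, Complex.exp_zero, mul_one] at hc
      rw [Complex.exp_neg, mul_inv_eq_one₀ (Complex.exp_ne_zero _)] at hc
      exact hc
    · rw [fderivWithin_of_isOpen isOpen_ball hw]
      simpa using (hder w hw).hasFDerivAt.fderiv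

/-- A quadratic bound for the Taylor remainder of a function with bounded real part. -/
theorem norm_sub_linear_le {h : ℂ → ℂ} {R M : ℝ} (hR : 0 < R) (hM : 0 < M) (h0 : h 0 = 0)
    (hd : DifferentiableOn ℂ h (ball 0 R)) (hre : ∀ z ∈ ball (0 : ℂ) R, (h z).re ≤ M)
    {z : ℂ} (hz : ‖z‖ < R / 2) : ‖h z - deriv h 0 * z‖ ≤ 4 * M * (‖z‖ / (R / 2)) ^ 2 := by
  have hR2 : 0 < R / 2 := by positivity
  have hsub : ball (0 : ℂ) (R / 2) ⊆ ball 0 R := ball_subset_ball (by linarith)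
  -- Borel–Carathéodory turns the one-sided bound on the real part into a bound on the modulus in
  -- the half-radius disc.
  have hB : ∀ w ∈ ball (0 : ℂ) (R / 2), ‖h w‖ ≤ 2 * M := by
    intro w hw
    have h1 := Complex.borelCaratheodory_zero hM hd hre hR (hsub hw) h0
    have h2 : ‖w‖ < R / 2 := by simpa using hw
    refine h1.trans ?_
    rw [div_le_iff₀ (by linarith)]
    gcongr
    linarith
  have hd2 := hd.mono hsub
  have hder : ‖deriv h 0‖ ≤ 2 * M / (R / 2) := by
    refine Complex.norm_deriv_le_div_of_mapsTo_ball hd2 (fun w hw => ?_) hR2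
    simpa [h0] using hB w hw
  have hk : DifferentiableOn ℂ (fun w => h w - deriv h 0 * w) (ball 0 (R / 2)) := by
    fun_prop
  -- Schwarz lemma for a function bounded by `4M` and vanishing to second order at `0`.
  have key := Complex.dist_le_mul_div_pow_of_mapsTo_ball_of_isLittleO (n := 1) (R₂ := 4 * M) hk
    (fun w hw => ?_) ?_ (z := z) (by simpa using hz)
  · simpa [h0] using key
  · have h2 : ‖w‖ < R / 2 := by simpa using hw
    simp only [h0, mul_zero, sub_zero, mem_closedBall, dist_zero_right]
    calc ‖h w - deriv h 0 * w‖ ≤ ‖h w‖ + ‖deriv h 0 * w‖ := norm_sub_le _ _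
      _ ≤ 2 * M + 2 * M / (R / 2) * (R / 2) := by
        rw [norm_mul]
        gcongr
        exact hB w hw
      _ = 4 * M := by
        field_simp
        ring
  · have h3 : HasDerivAt h (deriv h 0) 0 :=
      (hd.differentiableAt (isOpen_ball.mem_nhds (by simpa using hR))).hasDerivAt
    have h4 := h3.isLittleO
    refine (h4.congr_left fun w => ?_).trans_isBigO ?_
    · simp [h0, mul_comm]
    · simpa using Asymptotics.isBigO_refl (fun w : ℂ => ‖w‖) (𝓝 0) |>.of_norm_left

theorem deriv_prod_one_sub_div {ι : Type*} (b : ι → ℂ) (T : Finset ι) :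
    HasDerivAt (fun s : ℂ => ∏ i ∈ T, (1 - s / b i)) (-∑ i ∈ T, 1 / b i) 0 := by
  classical
  have h : ∀ i ∈ T, HasDerivAt (fun s : ℂ => 1 - s / b i) (-(1 / b i)) 0 := fun i _ =>
    ((hasDerivAt_id (0 : ℂ)).div_const (b i)).const_sub 1
  refine (HasDerivAt.fun_finsetProd h).congr_deriv ?_
  simp

/-- The partial product over the zeros in a disc differs from its limit by a small factor. -/
theorem exists_prod_eq_of_forall_norm_le {ι : Type*} {f : ℂ → ℂ} (hf : Differentiable ℂ f)
    (h0 : f 0 = 1) {b : ι → ℂ} (hb : ∀ z, {i | b i = z}.encard = analyticOrderAt f z)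
    {R M : ℝ} (hR : 0 < R) (hM : 0 < M) (hfM : ∀ s, ‖s‖ = 2 * R → ‖f s‖ ≤ Real.exp M)
    (T : Finset ι) (hT : ∀ i, i ∈ T ↔ ‖b i‖ ≤ R) {s : ℂ} (hs : ‖s‖ < R / 2) :
    ∃ δ : ℂ, ‖δ‖ ≤ 4 * M * (‖s‖ / (R / 2)) ^ 2 ∧
      ∏ i ∈ T, (1 - s / b i) * Complex.exp (s / b i)
        = f s * Complex.exp (-(deriv f 0 * s)) * Complex.exp (-δ) := by
  have hb0 := ne_zero_of_encard_eq (by simp [h0]) hb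
  obtain ⟨F, hF, hfF⟩ := exists_eq_prod_mul hf hb0 T (card_filter_le_analyticOrderAt hb T)
  have hF0 : F 0 = 1 := by
    have := congrFun hfF 0
    simpa [h0] using this.symm
  -- `T` contains all zeros of the disc with full multiplicity, which leaves order `0` for `F`.
  have hne : ∀ z ∈ ball (0 : ℂ) R, F z ≠ 0 := by
    intro z hz hFz
    have hz' : ‖z‖ ≤ R := by simpa using (mem_ball.1 hz).le
    have h1 : analyticOrderAt f z = ((T.filter (fun i => b i = z)).card : ℕ∞) := by
      rw [← hb, ← Set.encard_coe_eq_coe_finsetCard]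
      congr 1
      ext i
      simp only [mem_ofPred_eq, Finset.coe_filter, hT, iff_and_self]
      rintro rfl
      exact hz'
    rw [hfF, analyticOrderAt_mul (by fun_prop) (hF.analyticAt _),
      analyticOrderAt_prod_one_sub_div hb0] at h1
    have h2 : analyticOrderAt F z = 0 := by
      have : ((T.filter (fun i => b i = z)).card : ℕ∞) + analyticOrderAt F z
        = ((T.filter (fun i => b i = z)).card : ℕ∞) + 0 := by rw [h1, add_zero]
      exact ENat.add_right_injective_of_ne_top (ENat.natCast_ne_top _) this
    exact analyticOrderAt_ne_zero.2 ⟨hF.analyticAt z, hFz⟩ h2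
  -- On the circle of radius `2R` each divided factor has modulus at least 1, so `F` inherits the
  -- bound of `f`.
  have hFM : ∀ z ∈ ball (0 : ℂ) R, ‖F z‖ ≤ Real.exp M := by
    intro z hz
    refine norm_le_of_sphere hF (R := 2 * R) (by positivity) (fun w hw => ?_) ?_
    · have h1 : 1 ≤ ‖∏ i ∈ T, (1 - w / b i)‖ := by
        rw [norm_prod, ← Finset.prod_const_one (s := T)]
        exact Finset.prod_le_prod (by simp) fun i hi =>
          le_norm_one_sub_div (hb0 i) ((hT i).1 hi) (by rw [hw]; ring) (by norm_num)
      calc ‖F w‖ ≤ ‖∏ i ∈ T, (1 - w / b i)‖ * ‖F w‖ :=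
            le_mul_of_one_le_left (norm_nonneg _) h1
        _ = ‖f w‖ := by rw [hfF, Pi.mul_apply, norm_mul]
        _ ≤ _ := hfM w hw
    · have : ‖z‖ < R := by simpa using hz
      linarith
  obtain ⟨h, hh0, hhd, hhder, hhF⟩ := exists_exp_eq hF hF0 hne hR
  have hre : ∀ z ∈ ball (0 : ℂ) R, (h z).re ≤ M := by
    intro z hz
    have := hFM z hz
    rwa [hhF z hz, Complex.norm_exp, Real.exp_le_exp] at this
  refine ⟨h s - deriv h 0 * s, norm_sub_linear_le hR hM hh0 hhd hre hs, ?_⟩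
  have hsR : s ∈ ball (0 : ℂ) R := by
    simp only [mem_ball, dist_zero_right]
    linarith
  -- The convergence factors `exp (s / b i)` absorb the sum here, so that only `deriv f 0` and the
  -- quadratic error survive.
  have hf' : deriv f 0 = deriv F 0 - ∑ i ∈ T, 1 / b i := by
    have := (deriv_prod_one_sub_div b T).mul (hF 0).hasDerivAt
    rw [← hfF] at this
    rw [this.deriv]
    simp [hF0]
    ring
  rw [Finset.prod_mul_distrib, ← Complex.exp_sum, congrFun hfF s, Pi.mul_apply, hhF s hsR, hhder,
    hf', mul_assoc, mul_assoc, ← Complex.exp_add, ← Complex.exp_add]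
  congr 2
  rw [← Finset.sum_congr rfl fun i _ => (by ring : 1 / b i * s = s / b i), ← Finset.sum_mul]
  ring

theorem norm_one_sub_mul_exp_sub_one_le {w : ℂ} (hw : ‖w‖ ≤ 1) :
    ‖(1 - w) * Complex.exp w - 1‖ ≤ 3 * ‖w‖ ^ 2 := by
  have h1 := Complex.norm_exp_sub_one_sub_id_le hw
  have h2 : (1 - w) * Complex.exp w - 1 = (1 - w) * (Complex.exp w - 1 - w) - w ^ 2 := by ring
  rw [h2]
  calc _ ≤ ‖1 - w‖ * ‖Complex.exp w - 1 - w‖ + ‖w‖ ^ 2 := by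
        rw [← norm_mul, ← norm_pow]
        exact norm_sub_le _ _
    _ ≤ 2 * ‖w‖ ^ 2 + ‖w‖ ^ 2 := by
        gcongr
        exact (norm_sub_le _ _).trans (by simpa using (by linarith : 1 + ‖w‖ ≤ 2))
    _ = _ := by ring

theorem finite_norm_le_of_summable {ι : Type*} {b : ι → ℂ} (hb : ∀ i, b i ≠ 0)
    (hs : Summable fun i => (‖b i‖ ^ 2)⁻¹) (R : ℝ) : {i | ‖b i‖ ≤ R}.Finite := by
  rcases le_or_gt R 0 with hR | hR
  · convert Set.finite_empty
    ext i
    simpa using hR.trans_lt (norm_pos_iff.2 (hb i))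
  · have := hs.tendsto_cofinite_zero.eventually (gt_mem_nhds (show 0 < (R ^ 2)⁻¹ by positivity))
    refine this.subset fun i hi => ?_
    have hb' := norm_pos_iff.2 (hb i)
    simp only [mem_compl_iff, mem_ofPred_eq, not_lt] at hi ⊢
    gcongr

theorem multipliable_genus_one {ι : Type*} {b : ι → ℂ} (hb : ∀ i, b i ≠ 0)
    (hs : Summable fun i => (‖b i‖ ^ 2)⁻¹) (s : ℂ) :
    Multipliable fun i => (1 - s / b i) * Complex.exp (s / b i) := by
  have h1 : Summable fun i => ((1 - s / b i) * Complex.exp (s / b i) - 1) := by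
    refine Summable.of_norm_bounded_eventually
      (g := fun i => 3 * ‖s‖ ^ 2 * (‖b i‖ ^ 2)⁻¹) (hs.mul_left _) ?_
    refine (finite_norm_le_of_summable hb hs ‖s‖).subset fun i hi => ?_
    by_contra hcon
    refine hi ?_
    simp only [mem_ofPred_eq, not_le] at hcon
    have h2 : ‖s / b i‖ ≤ 1 := by
      rw [norm_div, div_le_one (norm_pos_iff.2 (hb i))]
      exact hcon.le
    refine (norm_one_sub_mul_exp_sub_one_le h2).trans (le_of_eq ?_)
    rw [norm_div]
    ring
  have := multipliable_one_add_of_summable h1.norm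
  simpa using this

/-- **Hadamard factorization**, in genus one: an entire function with `f 0 = 1`, of growth
`exp (o(‖s‖ ^ 2))`, and with zeros `b` such that `∑ ‖b i‖⁻²` converges. -/
theorem hasProd_genus_one {ι : Type*} {f : ℂ → ℂ} (hf : Differentiable ℂ f) (h0 : f 0 = 1)
    {b : ι → ℂ} (hb : ∀ z, {i | b i = z}.encard = analyticOrderAt f z)
    (hs : Summable fun i => (‖b i‖ ^ 2)⁻¹) {G : ℝ → ℝ} (hG : ∀ s, ‖f s‖ ≤ Real.exp (G ‖s‖))
    (hGpos : ∀ᶠ R in atTop, 0 < G (2 * R))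
    (hGlim : Tendsto (fun R => G (2 * R) / R ^ 2) atTop (𝓝 0)) (s : ℂ) :
    HasProd (fun i => (1 - s / b i) * Complex.exp (s / b i))
      (f s * Complex.exp (-(deriv f 0 * s))) := by
  have hb0 := ne_zero_of_encard_eq (by simp [h0]) hb
  have hfin := finite_norm_le_of_summable hb0 hs
  have hmul := (multipliable_genus_one hb0 hs s).hasProd
  -- The product is already known to converge unconditionally, so its value may be computed along
  -- the zeros in growing discs.
  have htend : Tendsto (fun R => (hfin R).toFinset) atTop atTop :=
    tendsto_atTop_finset_of_monotone
      (fun R R' h i hi => by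
        simp only [Finite.mem_toFinset, mem_ofPred_eq] at hi ⊢
        exact hi.trans h)
      (fun i => ⟨‖b i‖, by simp⟩)
  have h1 := Tendsto.comp hmul htend
  have h2 : Tendsto (fun R => ∏ i ∈ (hfin R).toFinset, (1 - s / b i) * Complex.exp (s / b i)) atTop
      (𝓝 (f s * Complex.exp (-(deriv f 0 * s)))) := by
    have hex : ∀ᶠ R in atTop, ∃ δ : ℂ, ‖δ‖ ≤ 4 * G (2 * R) * (‖s‖ / (R / 2)) ^ 2 ∧
        ∏ i ∈ (hfin R).toFinset, (1 - s / b i) * Complex.exp (s / b i)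
          = f s * Complex.exp (-(deriv f 0 * s)) * Complex.exp (-δ) := by
      filter_upwards [hGpos, eventually_gt_atTop (2 * ‖s‖), eventually_gt_atTop 0] with R h3 h4 h5
      exact exists_prod_eq_of_forall_norm_le hf h0 hb h5 h3 (fun w hw => hw ▸ hG w) _
        (fun i => by simp) (by linarith)
    obtain ⟨δ, hδ⟩ := hex.choice
    have hδ0 : Tendsto δ atTop (𝓝 0) := by
      refine squeeze_zero_norm' (hδ.mono fun R h => h.1) ?_
      have := (hGlim.const_mul (16 * ‖s‖ ^ 2))
      rw [mul_zero] at this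
      refine this.congr' ?_
      filter_upwards [eventually_gt_atTop 0] with R hR
      field_simp
      ring
    have h3 : Tendsto (fun R => f s * Complex.exp (-(deriv f 0 * s)) * Complex.exp (-δ R)) atTop
        (𝓝 (f s * Complex.exp (-(deriv f 0 * s)) * Complex.exp (-0))) :=
      ((Complex.continuous_exp.tendsto _).comp hδ0.neg).const_mul _
    rw [neg_zero, Complex.exp_zero, mul_one] at h3
    exact h3.congr' (hδ.mono fun R h => h.2.symm)
  rw [← tendsto_nhds_unique h1 h2]
  exact hmul

end Hadamard

/-! ### Oscillatory integrals by integration by parts. -/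

section RealIntegrals

theorem integrableOn_rpow_mul_exp (a : ℝ) {c : ℝ} (hc : 0 < c) :
    IntegrableOn (fun x : ℝ => x ^ a * Real.exp (-c * x)) (Ioi 1) := by
  refine integrable_of_isBigO_exp_neg (b := c / 2) (by positivity) ?_ ?_
  · refine ContinuousOn.mul (fun x hx => ?_) (by fun_prop)
    exact (Real.continuousAt_rpow_const x a
      (Or.inl (by linarith [mem_Ici.1 hx] : x ≠ 0 ))).continuousWithinAt
  · have h := (isLittleO_rpow_exp_pos_mul_atTop a (half_pos hc)).isBigO.mul
      (Asymptotics.isBigO_refl (fun x : ℝ => Real.exp (-c * x)) atTop)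
    refine h.trans (Asymptotics.isBigO_of_le _ fun x => le_of_eq ?_)
    rw [← Real.exp_add]
    congr 2
    ring

theorem integrableOn_mul_rpow_mul_exp {w : ℝ → ℝ} (a : ℝ) {c C : ℝ} (hc : 0 < c)
    (hw : ContinuousOn w (Ici 1)) (hC : ∀ x, 1 ≤ x → |w x| ≤ C) :
    IntegrableOn (fun x : ℝ => w x * (x ^ a * Real.exp (-c * x))) (Ioi 1) := by
  refine Integrable.bdd_mul (c := C) (integrableOn_rpow_mul_exp a hc)
    ((hw.mono Ioi_subset_Ici_self).aestronglyMeasurable measurableSet_Ioi) ?_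
  exact (ae_restrict_iff' measurableSet_Ioi).2 (ae_of_all _ fun x hx => hC x (mem_Ioi.1 hx).le)

theorem tendsto_mul_rpow_mul_exp {w : ℝ → ℝ} (a : ℝ) {c C : ℝ} (hc : 0 < c)
    (hC : ∀ x, 1 ≤ x → |w x| ≤ C) :
    Tendsto (fun x : ℝ => w x * (x ^ a * Real.exp (-c * x))) atTop (𝓝 0) := by
  have h := (tendsto_rpow_mul_exp_neg_mul_atTop_nhds_zero a c hc).const_mul C
  rw [mul_zero] at h
  refine squeeze_zero_norm' ?_ h
  filter_upwards [eventually_ge_atTop 1] with x hx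
  have : 0 ≤ x ^ a * Real.exp (-c * x) := by positivity
  rw [Real.norm_eq_abs, abs_mul, abs_of_nonneg this]
  gcongr
  exact hC x hx

/-- Integration by parts against `x ^ a * exp (-c * x)` on `(1, ∞)`. -/
theorem integral_deriv_mul_rpow_mul_exp {w w' : ℝ → ℝ} (a : ℝ) {c C C' : ℝ} (hc : 0 < c)
    (hw : ∀ x, 1 ≤ x → HasDerivAt w (w' x) x) (hw' : ContinuousOn w' (Ici 1))
    (hC : ∀ x, 1 ≤ x → |w x| ≤ C) (hC' : ∀ x, 1 ≤ x → |w' x| ≤ C') :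
    ∫ x in Ioi (1 : ℝ), w' x * (x ^ a * Real.exp (-c * x))
      = -(w 1 * Real.exp (-c)) +
        ∫ x in Ioi (1 : ℝ), w x * (c - a / x) * (x ^ a * Real.exp (-c * x)) := by
  have hwc : ContinuousOn w (Ici 1) := fun x hx => (hw x hx).continuousAt.continuousWithinAt
  have hdiv : ContinuousOn (fun x : ℝ => c - a / x) (Ici 1) :=
    continuousOn_const.sub (continuousOn_const.div continuousOn_id fun x hx => by
      have := mem_Ici.1 hx
      exact (by linarith : (0 : ℝ) < x).ne')
  have i1 := integrableOn_mul_rpow_mul_exp a hc hw' hC'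
  have i2 : IntegrableOn (fun x : ℝ => w x * (c - a / x) * (x ^ a * Real.exp (-c * x)))
      (Ioi 1) := by
    refine integrableOn_mul_rpow_mul_exp (C := C * (c + |a|)) a hc (hwc.mul hdiv) fun x hx => ?_
    rw [abs_mul]
    have h0 : 0 ≤ C := (abs_nonneg _).trans (hC x hx)
    gcongr
    · exact hC x hx
    · refine (abs_sub _ _).trans ?_
      rw [abs_of_pos hc, abs_div, abs_of_pos (by linarith : (0 : ℝ) < x)]
      gcongr
      exact div_le_self (abs_nonneg a) hx
  have hder : ∀ x ∈ Ioi (1 : ℝ), HasDerivAt (fun x : ℝ => w x * (x ^ a * Real.exp (-c * x)))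
      (w' x * (x ^ a * Real.exp (-c * x)) - w x * (c - a / x) * (x ^ a * Real.exp (-c * x))) x := by
    intro x hx
    have hx0 : 0 < x := by linarith [mem_Ioi.1 hx]
    have h1 := Real.hasDerivAt_rpow_const (p := a) (Or.inl hx0.ne')
    have h2 : HasDerivAt (fun x : ℝ => Real.exp (-c * x)) (Real.exp (-c * x) * (-c)) x := by
      simpa using ((hasDerivAt_id x).const_mul (-c)).exp
    refine ((hw x (mem_Ioi.1 hx).le).fun_mul (h1.fun_mul h2)).congr_deriv ?_
    rw [Real.rpow_sub_one hx0.ne']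
    field_simp
    ring
  have hcont : ContinuousWithinAt (fun x : ℝ => w x * (x ^ a * Real.exp (-c * x))) (Ici 1) 1 := by
    refine (hwc 1 self_mem_Ici).mul (ContinuousAt.continuousWithinAt ?_)
    exact (Real.continuousAt_rpow_const 1 a (Or.inl one_ne_zero)).mul (by fun_prop)
  have key := integral_Ioi_of_hasDerivAt_of_tendsto hcont hder (i1.sub i2)
    (tendsto_mul_rpow_mul_exp a hc hC)
  rw [integral_sub i1 i2] at key
  simp only [Real.one_rpow, mul_one, one_mul] at key
  linarith

variable {a c τ : ℝ}

theorem continuousOn_trig_log_div {F : ℝ → ℝ} (hF : Continuous F) (τ : ℝ) :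
    ContinuousOn (fun x : ℝ => τ * (F (τ * Real.log x) / x)) (Ici 1) := by
  have h0 : ∀ x ∈ Ici (1 : ℝ), x ≠ 0 := fun x hx => by
    have := mem_Ici.1 hx
    exact (by linarith : (0 : ℝ) < x).ne'
  refine continuousOn_const.mul (ContinuousOn.div ?_ continuousOn_id h0)
  exact hF.comp_continuousOn (continuousOn_const.mul (Real.continuousOn_log.mono h0))

theorem abs_mul_div_le {y x : ℝ} (hy : |y| ≤ 1) (hx : 1 ≤ x) (τ : ℝ) :
    |τ * (y / x)| ≤ |τ| := by
  rw [abs_mul, abs_div, abs_of_pos (by linarith : (0 : ℝ) < x)]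
  exact mul_le_of_le_one_right (abs_nonneg _) ((div_le_one (by linarith)).2 (hy.trans hx))

theorem integral_sin_nonneg (hc : 0 < c) (hac : a ≤ c) (hτ : 0 < τ) :
    0 ≤ ∫ x in Ioi (1 : ℝ), Real.sin (τ * Real.log x) / x * (x ^ a * Real.exp (-c * x)) := by
  -- The primitive `1 - cos` is nonnegative and vanishes at `x = 1`: there is no boundary term, and
  -- `a ≤ c` makes the remaining integrand nonnegative.
  have key := integral_deriv_mul_rpow_mul_exp (w := fun x => 1 - Real.cos (τ * Real.log x))
    (w' := fun x => τ * (Real.sin (τ * Real.log x) / x)) a (C := 2) (C' := |τ|) hc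
    (fun x hx => ?_) (continuousOn_trig_log_div Real.continuous_sin τ) (fun x _ => ?_)
    (fun x hx => abs_mul_div_le (Real.abs_sin_le_one _) hx τ)
  · simp only [mul_assoc, integral_const_mul] at key
    refine le_of_mul_le_mul_left (a := τ) ?_ hτ
    rw [key, mul_zero]
    simp only [Real.log_one, mul_zero, Real.cos_zero, sub_self, zero_mul, neg_zero, zero_add]
    refine setIntegral_nonneg measurableSet_Ioi fun x hx => ?_
    have hx1 : 1 < x := hx
    have h1 : 0 ≤ c - a / x := by
      rw [sub_nonneg, div_le_iff₀ (by linarith)]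
      nlinarith
    have h2 : 0 ≤ 1 - Real.cos (τ * Real.log x) := by linarith [Real.cos_le_one (τ * Real.log x)]
    positivity
  · have h1 := ((Real.hasDerivAt_log (by linarith : x ≠ 0)).const_mul τ).cos.const_sub 1
    refine h1.congr_deriv ?_
    ring
  · rw [abs_le]
    constructor <;>
      linarith [Real.cos_le_one (τ * Real.log x), Real.neg_one_le_cos (τ * Real.log x)]

theorem integral_sub_div_mul_rpow_mul_exp (a : ℝ) (hc : 0 < c) :
    ∫ x in Ioi (1 : ℝ), (c - a / x) * (x ^ a * Real.exp (-c * x)) = Real.exp (-c) := by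
  have key := integral_deriv_mul_rpow_mul_exp (w := fun _ => 1) (w' := fun _ => 0) a (C := 1)
    (C' := 0) hc (fun x _ => hasDerivAt_const x 1) continuousOn_const (by simp) (by simp)
  simp only [zero_mul, integral_zero, one_mul] at key
  linarith

/-- After integration by parts, `|sin| ≤ 1` leaves a nonnegative exact derivative, whose integral is
`exp (-c)`. -/
theorem abs_integral_cos_le (hc : 0 < c) (hac : a ≤ c) (hτ : 0 < τ) :
    |∫ x in Ioi (1 : ℝ), Real.cos (τ * Real.log x) / x * (x ^ a * Real.exp (-c * x))|
      ≤ Real.exp (-c) / τ := by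
  have key := integral_deriv_mul_rpow_mul_exp (w := fun x => Real.sin (τ * Real.log x))
    (w' := fun x => τ * (Real.cos (τ * Real.log x) / x)) a (C := 1) (C' := |τ|) hc
    (fun x hx => ?_) (continuousOn_trig_log_div Real.continuous_cos τ)
    (fun x _ => Real.abs_sin_le_one _)
    (fun x hx => abs_mul_div_le (Real.abs_cos_le_one _) hx τ)
  · simp only [mul_assoc, integral_const_mul] at key
    simp only [Real.log_one, mul_zero, Real.sin_zero, zero_mul, neg_zero, zero_add] at key
    rw [le_div_iff₀ hτ, mul_comm]
    nth_rewrite 1 [← abs_of_pos hτ]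
    rw [← abs_mul, key, ← integral_sub_div_mul_rpow_mul_exp a hc]
    have hpos : ∀ x ∈ Ioi (1 : ℝ), 0 ≤ (c - a / x) * (x ^ a * Real.exp (-c * x)) := by
      intro x hx
      have hx1 : 1 < x := hx
      have h1 : 0 ≤ c - a / x := by
        rw [sub_nonneg, div_le_iff₀ (by linarith)]
        nlinarith
      positivity
    rw [← Real.norm_eq_abs]
    refine norm_integral_le_of_norm_le (μ := volume.restrict (Ioi (1 : ℝ))) ?_
      ((ae_restrict_iff' measurableSet_Ioi).2 (ae_of_all _ fun x hx => ?_))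
    -- The dominating function is integrable: otherwise its integral would be `0` by convention,
    -- whereas it is `exp (-c)`.
    · by_contra h
      have h1 := integral_undef h
      rw [integral_sub_div_mul_rpow_mul_exp a hc] at h1
      exact (Real.exp_pos _).ne' h1
    · rw [norm_mul, Real.norm_eq_abs, Real.norm_eq_abs, abs_of_nonneg (hpos x hx)]
      exact mul_le_of_le_one_left (hpos x hx) (Real.abs_sin_le_one _)
  · have h1 := ((Real.hasDerivAt_log (by linarith : x ≠ 0)).const_mul τ).sin
    refine h1.congr_deriv ?_
    ring

end RealIntegrals

/-! ### Termwise analysis of the theta integral. -/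

section ThetaIntegral

/-- The exponent `π (n + 1) ^ 2` of the `n`-th term of `(θ - 1) / 2`. -/
noncomputable def thetaExponent (n : ℕ) : ℝ := Real.pi * ((n : ℝ) + 1) ^ 2

theorem three_le_thetaExponent (n : ℕ) : 3 ≤ thetaExponent n := by
  unfold thetaExponent
  nlinarith [Real.pi_gt_three, sq_nonneg (n : ℝ), (Nat.cast_nonneg n : (0 : ℝ) ≤ n),
    mul_nonneg Real.pi_pos.le (Nat.cast_nonneg n : (0 : ℝ) ≤ n),
    mul_nonneg Real.pi_pos.le (sq_nonneg (n : ℝ))]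

theorem thetaExponent_pos (n : ℕ) : 0 < thetaExponent n := by
  linarith [three_le_thetaExponent n]

theorem hasSum_theta {x : ℝ} (hx : 0 < x) :
    HasSum (fun n : ℕ => ((Real.exp (-thetaExponent n * x) : ℝ) : ℂ))
      ((theta (x : ℂ) - 1) / 2) := by
  have h := hasSum_nat_jacobiTheta (τ := Complex.I * x) (by simpa using hx)
  unfold theta
  refine h.congr_fun fun n => ?_
  rw [thetaExponent]
  push_cast
  congr 1
  linear_combination (-(Real.pi : ℂ) * ((n : ℂ) + 1) ^ 2 * x) * Complex.I_sq

theorem exp_neg_three_le : Real.exp (-3) ≤ 1 / 20 := by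
  have h := Real.exp_one_gt_d9
  have h3 : Real.exp 3 = Real.exp 1 ^ 3 := by
    rw [← Real.exp_nat_mul]
    norm_num
  rw [Real.exp_neg, inv_le_comm₀ (Real.exp_pos _) (by norm_num), h3]
  calc (1 / 20 : ℝ)⁻¹ ≤ (2.7182818283 : ℝ) ^ 3 := by norm_num
    _ ≤ _ := by gcongr

/-- From `(n + 1)² x ≥ n + x` and `π > 3`; a geometric factor splits off uniformly in `x ≥ 1`. -/
theorem exp_neg_thetaExponent_le (n : ℕ) {x : ℝ} (hx : 1 ≤ x) :
    Real.exp (-thetaExponent n * x) ≤ (1 / 20) ^ n * Real.exp (-3 * x) := by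
  have hn : (0 : ℝ) ≤ n := Nat.cast_nonneg n
  calc Real.exp (-thetaExponent n * x) ≤ Real.exp (n * (-3) + -3 * x) := by
        rw [Real.exp_le_exp, thetaExponent]
        have h1 : 3 * (n + x) ≤ Real.pi * (n + x) := by
          gcongr
          exact Real.pi_gt_three.le
        have h2 : n + x ≤ ((n : ℝ) + 1) ^ 2 * x := by nlinarith [mul_nonneg hn (sub_nonneg.2 hx)]
        nlinarith [mul_le_mul_of_nonneg_left h2 Real.pi_pos.le]
    _ = Real.exp (-3) ^ n * Real.exp (-3 * x) := by rw [Real.exp_add, Real.exp_nat_mul]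
    _ ≤ _ := by
        gcongr
        exact exp_neg_three_le

/-- The `n`-th term of the series for `thetaIntegral`. -/
noncomputable def thetaTerm (n : ℕ) (s : ℂ) : ℂ :=
  ∫ x in Ioi (1 : ℝ), (x : ℂ) ^ (s / 2 - 1) * ((Real.exp (-thetaExponent n * x) : ℝ) : ℂ)

theorem norm_integrand (s : ℂ) (c : ℝ) {x : ℝ} (hx : x ∈ Ioi (1 : ℝ)) :
    ‖(x : ℂ) ^ (s / 2 - 1) * ((Real.exp (-c * x) : ℝ) : ℂ)‖
      = x ^ (s.re / 2 - 1) * Real.exp (-c * x) := by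
  have hx1 : 1 < x := hx
  rw [norm_mul, Complex.norm_cpow_eq_rpow_re_of_pos (by linarith), Complex.norm_real,
    Real.norm_eq_abs, abs_of_pos (Real.exp_pos _)]
  simp

theorem integrableOn_integrand (s : ℂ) {c : ℝ} (hc : 0 < c) :
    IntegrableOn (fun x : ℝ => (x : ℂ) ^ (s / 2 - 1) * ((Real.exp (-c * x) : ℝ) : ℂ)) (Ioi 1) := by
  refine (integrableOn_rpow_mul_exp (s.re / 2 - 1) hc).mono' ?_ ?_
  · refine ContinuousOn.aestronglyMeasurable (ContinuousOn.mul (fun x hx => ?_) ?_)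
      measurableSet_Ioi
    · have hx1 : 1 < x := hx
      refine ContinuousAt.continuousWithinAt ?_
      exact (continuousAt_cpow_const (Or.inl (by simpa using by linarith))).comp
        Complex.continuous_ofReal.continuousAt
    · exact (by fun_prop : Continuous fun x : ℝ => ((Real.exp (-c * x) : ℝ) : ℂ)).continuousOn
  · exact (ae_restrict_iff' measurableSet_Ioi).2
      (ae_of_all _ fun x hx => (norm_integrand s c hx).le)

/-- The integral `∫_1^∞ x ^ (σ / 2 - 1) exp (-3 x) dx`, which dominates `thetaIntegral`. -/
noncomputable def thetaBound (σ : ℝ) : ℝ :=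
  ∫ x in Ioi (1 : ℝ), x ^ (σ / 2 - 1) * Real.exp (-3 * x)

theorem integral_norm_le (n : ℕ) (s : ℂ) :
    ∫ x in Ioi (1 : ℝ), ‖(x : ℂ) ^ (s / 2 - 1) * ((Real.exp (-thetaExponent n * x) : ℝ) : ℂ)‖
      ≤ (1 / 20) ^ n * thetaBound s.re := by
  unfold thetaBound
  rw [← integral_const_mul]
  refine setIntegral_mono_on (integrableOn_integrand s (thetaExponent_pos n)).norm
    ((integrableOn_rpow_mul_exp _ three_pos).const_mul _) measurableSet_Ioi fun x hx => ?_
  rw [norm_integrand s _ hx]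
  have hx1 : 1 < x := hx
  calc _ ≤ x ^ (s.re / 2 - 1) * ((1 / 20) ^ n * Real.exp (-3 * x)) := by
        gcongr
        exact exp_neg_thetaExponent_le n hx1.le
    _ = _ := by ring

theorem thetaIntegral_eq (s : ℂ) :
    thetaIntegral s = ∫ x in Ioi (1 : ℝ), (x : ℂ) ^ (s / 2 - 1) * ((theta (x : ℂ) - 1) / 2) := by
  unfold thetaIntegral
  refine setIntegral_congr_fun measurableSet_Ioi fun x hx => ?_
  have hx1 : 1 < x := hx
  have hx0 : (x : ℂ) ≠ 0 := by exact_mod_cast (by linarith : x ≠ 0)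
  simp only [Complex.cpow_sub _ _ hx0, Complex.cpow_one]
  ring

theorem summable_geometric_twentieth (C : ℝ) : Summable fun n : ℕ => (1 / 20 : ℝ) ^ n * C :=
  (summable_geometric_of_lt_one (by norm_num) (by norm_num)).mul_right _

theorem tsum_geometric_twentieth (C : ℝ) : ∑' n : ℕ, (1 / 20 : ℝ) ^ n * C = 20 / 19 * C := by
  rw [tsum_mul_right, tsum_geometric_of_lt_one (by norm_num) (by norm_num)]
  norm_num

theorem hasSum_thetaTerm (s : ℂ) : HasSum (fun n => thetaTerm n s) (thetaIntegral s) := by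
  have h := hasSum_integral_of_summable_integral_norm (μ := volume.restrict (Ioi (1 : ℝ)))
    (F := fun (n : ℕ) (x : ℝ) =>
      (x : ℂ) ^ (s / 2 - 1) * ((Real.exp (-thetaExponent n * x) : ℝ) : ℂ))
    (fun n => integrableOn_integrand s (thetaExponent_pos n))
    (Summable.of_nonneg_of_le (fun n => integral_nonneg fun x => norm_nonneg _)
      (fun n => integral_norm_le n s) (summable_geometric_twentieth _))
  suffices hI : thetaIntegral s = ∫ x in Ioi (1 : ℝ), ∑' n : ℕ,
      (x : ℂ) ^ (s / 2 - 1) * ((Real.exp (-thetaExponent n * x) : ℝ) : ℂ) from hI ▸ h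
  rw [thetaIntegral_eq]
  refine setIntegral_congr_fun measurableSet_Ioi fun x hx => ?_
  have hx1 : 1 < x := hx
  exact (((hasSum_theta (by linarith : 0 < x)).mul_left _).tsum_eq).symm

theorem norm_thetaIntegral_le (s : ℂ) : ‖thetaIntegral s‖ ≤ 20 / 19 * thetaBound s.re := by
  rw [← (hasSum_thetaTerm s).tsum_eq]
  refine tsum_of_norm_bounded (g := fun n : ℕ => (1 / 20 : ℝ) ^ n * thetaBound s.re) ?_ fun n =>
    (norm_integral_le_integral_norm _).trans (integral_norm_le n s)
  rw [← tsum_geometric_twentieth]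
  exact (summable_geometric_twentieth _).hasSum

theorem thetaTerm_conj (n : ℕ) (s : ℂ) :
    thetaTerm n (starRingEnd ℂ s) = starRingEnd ℂ (thetaTerm n s) := by
  unfold thetaTerm
  rw [← integral_conj]
  refine setIntegral_congr_fun measurableSet_Ioi fun x hx => ?_
  have hx1 : 1 < x := hx
  have harg : (x : ℂ).arg ≠ Real.pi := by
    rw [Complex.arg_ofReal_of_nonneg (by linarith)]
    exact Real.pi_ne_zero.symm
  have hs : starRingEnd ℂ s / 2 - 1 = starRingEnd ℂ (s / 2 - 1) := by simp [map_ofNat]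
  simp only [map_mul, Complex.conj_ofReal]
  rw [hs, Complex.cpow_conj _ _ harg, Complex.conj_ofReal]

theorem thetaIntegral_conj (s : ℂ) :
    thetaIntegral (starRingEnd ℂ s) = starRingEnd ℂ (thetaIntegral s) := by
  have h := (hasSum_thetaTerm s).map (starRingEnd ℂ) Complex.continuous_conj
  refine (hasSum_thetaTerm _).unique (h.congr_fun fun n => ?_)
  exact thetaTerm_conj n s

theorem cpow_re_im (s : ℂ) {x : ℝ} (hx : 0 < x) :
    (x : ℂ) ^ (s / 2 - 1) = (Real.cos (s.im / 2 * Real.log x) / x * x ^ (s.re / 2) : ℝ) +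
      (Real.sin (s.im / 2 * Real.log x) / x * x ^ (s.re / 2) : ℝ) * Complex.I := by
  have hx0 : (x : ℂ) ≠ 0 := by exact_mod_cast hx.ne'
  rw [Complex.cpow_sub _ _ hx0, Complex.cpow_one, Complex.cpow_def_of_ne_zero hx0,
    ← Complex.ofReal_log hx.le, Real.rpow_def_of_pos hx]
  have : (Real.log x : ℂ) * (s / 2) = ((Real.log x * (s.re / 2) : ℝ) : ℂ)
      + ((s.im / 2 * Real.log x : ℝ) : ℂ) * Complex.I := by
    nth_rewrite 1 [← Complex.re_add_im s]
    push_cast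
    ring
  rw [this, Complex.exp_add, Complex.exp_mul_I, ← Complex.ofReal_cos, ← Complex.ofReal_sin]
  push_cast
  field_simp

theorem thetaTerm_re (n : ℕ) (s : ℂ) : (thetaTerm n s).re =
    ∫ x in Ioi (1 : ℝ), Real.cos (s.im / 2 * Real.log x) / x *
      (x ^ (s.re / 2) * Real.exp (-thetaExponent n * x)) := by
  unfold thetaTerm
  rw [← RCLike.re_eq_complex_re, ← integral_re (integrableOn_integrand s (thetaExponent_pos n))]
  refine setIntegral_congr_fun measurableSet_Ioi fun x hx => ?_
  have hx1 : 1 < x := hx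
  simp only [RCLike.re_eq_complex_re]
  rw [cpow_re_im s (by linarith), Complex.re_mul_ofReal]
  simp only [Complex.add_re, Complex.ofReal_re, Complex.re_ofReal_mul, Complex.I_re, mul_zero,
    add_zero]
  ring

theorem thetaTerm_im (n : ℕ) (s : ℂ) : (thetaTerm n s).im =
    ∫ x in Ioi (1 : ℝ), Real.sin (s.im / 2 * Real.log x) / x *
      (x ^ (s.re / 2) * Real.exp (-thetaExponent n * x)) := by
  unfold thetaTerm
  rw [← RCLike.im_eq_complex_im, ← integral_im (integrableOn_integrand s (thetaExponent_pos n))]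
  refine setIntegral_congr_fun measurableSet_Ioi fun x hx => ?_
  have hx1 : 1 < x := hx
  simp only [RCLike.im_eq_complex_im]
  rw [cpow_re_im s (by linarith), Complex.im_mul_ofReal]
  simp only [Complex.add_im, Complex.ofReal_im, Complex.im_ofReal_mul, Complex.I_im, mul_one,
    zero_add]
  ring

/-- Every term is nonnegative; the bound 6 comes from needing `s.re / 2 ≤ 3 ≤ thetaExponent n`. -/
theorem thetaIntegral_im_nonneg {s : ℂ} (hs : 0 < s.im) (hre : s.re ≤ 6) :
    0 ≤ (thetaIntegral s).im := by
  refine (Complex.hasSum_im (hasSum_thetaTerm s)).nonneg fun n => ?_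
  rw [thetaTerm_im]
  exact integral_sin_nonneg (thetaExponent_pos n)
    (by linarith [three_le_thetaExponent n]) (by positivity)

theorem abs_re_thetaIntegral_le {s : ℂ} (hs : 0 < s.im) (hre : s.re ≤ 6) :
    |(thetaIntegral s).re| ≤ 2 / 19 / s.im := by
  have h := Complex.hasSum_re (hasSum_thetaTerm s)
  rw [← h.tsum_eq]
  have h2 := tsum_of_norm_bounded (f := fun n => (thetaTerm n s).re)
    (g := fun n : ℕ => (1 / 20 : ℝ) ^ n * (1 / 20 * (2 / s.im)))
    (summable_geometric_twentieth _).hasSum fun n => ?_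
  · rw [tsum_geometric_twentieth, Real.norm_eq_abs] at h2
    refine h2.trans (le_of_eq ?_)
    field_simp
  · rw [thetaTerm_re, Real.norm_eq_abs]
    refine (abs_integral_cos_le (thetaExponent_pos n)
      (by linarith [three_le_thetaExponent n]) (by positivity)).trans ?_
    have h3 := exp_neg_thetaExponent_le n le_rfl
    have h4 := exp_neg_three_le
    simp only [mul_one] at h3
    calc _ = Real.exp (-thetaExponent n) * (2 / s.im) := by field_simp
      _ ≤ (1 / 20) ^ n * (1 / 20) * (2 / s.im) := by
        gcongr
        refine h3.trans ?_
        gcongr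
      _ = _ := by ring

theorem thetaIntegral_ofReal (σ : ℝ) : thetaIntegral σ = ((thetaIntegral σ).re : ℂ) := by
  have h := thetaIntegral_conj σ
  rw [Complex.conj_ofReal] at h
  exact (Complex.conj_eq_iff_re.1 h.symm).symm

theorem thetaTerm_ofReal_re (n : ℕ) (σ : ℝ) : (thetaTerm n σ).re =
    ∫ x in Ioi (1 : ℝ), x ^ (σ / 2 - 1) * Real.exp (-thetaExponent n * x) := by
  rw [thetaTerm_re]
  refine setIntegral_congr_fun measurableSet_Ioi fun x hx => ?_
  have hx1 : 1 < x := hx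
  simp only [Complex.ofReal_im, zero_div, zero_mul, Real.cos_zero, Complex.ofReal_re]
  rw [Real.rpow_sub_one (by linarith)]
  ring

theorem thetaIntegral_re_mono {σ σ' : ℝ} (h : σ ≤ σ') :
    (thetaIntegral σ).re ≤ (thetaIntegral σ').re := by
  refine hasSum_le (fun n => ?_) (Complex.hasSum_re (hasSum_thetaTerm σ))
    (Complex.hasSum_re (hasSum_thetaTerm σ'))
  rw [thetaTerm_ofReal_re, thetaTerm_ofReal_re]
  refine setIntegral_mono_on (integrableOn_rpow_mul_exp _ (thetaExponent_pos n))
    (integrableOn_rpow_mul_exp _ (thetaExponent_pos n)) measurableSet_Ioi fun x hx => ?_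
  have hx1 : 1 < x := hx
  gcongr
  exact hx1.le

/-- Only the term `n = 0` on `(r, r + 1]` is kept. Leaving `r` free is what later beats any
exponential in `σ`. -/
theorem le_thetaIntegral_re {σ r : ℝ} (hσ : 2 ≤ σ) (hr : 1 ≤ r) :
    r ^ (σ / 2 - 1) * Real.exp (-Real.pi * (r + 1)) ≤ (thetaIntegral σ).re := by
  have h0 : ∀ n, 0 ≤ (thetaTerm n σ).re := fun n => by
    rw [thetaTerm_ofReal_re]
    refine setIntegral_nonneg measurableSet_Ioi fun x hx => ?_
    have hx1 : 1 < x := hx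
    positivity
  refine le_trans ?_ (le_hasSum (Complex.hasSum_re (hasSum_thetaTerm σ)) 0 fun n _ => h0 n)
  rw [thetaTerm_ofReal_re]
  have hI := integrableOn_rpow_mul_exp (σ / 2 - 1) (thetaExponent_pos 0)
  have hsub : Ioc r (r + 1) ⊆ Ioi 1 := fun x hx => lt_of_le_of_lt hr hx.1
  calc _ = ∫ x in Ioc r (r + 1), r ^ (σ / 2 - 1) * Real.exp (-Real.pi * (r + 1)) := by simp
    _ ≤ ∫ x in Ioc r (r + 1), x ^ (σ / 2 - 1) * Real.exp (-thetaExponent 0 * x) := by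
      refine setIntegral_mono_on continuous_const.integrableOn_Ioc (hI.mono_set hsub) measurableSet_Ioc
        fun x hx => ?_
      have hπ := Real.pi_pos
      have h1 : 0 ≤ σ / 2 - 1 := by linarith
      have h2 := hx.1.le
      have h3 := hx.2
      gcongr ?_ * Real.exp ?_
      · exact Real.rpow_nonneg (by linarith) _
      · exact Real.rpow_le_rpow (by linarith) h2 h1
      · simp only [thetaExponent, CharP.cast_eq_zero, zero_add, one_pow, mul_one]
        nlinarith
    _ ≤ _ := setIntegral_mono_set hI ((ae_restrict_iff' measurableSet_Ioi).2
        (ae_of_all _ fun x hx => by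
          have hx1 : 1 < x := hx
          simp only [Pi.zero_apply]
          positivity)) (Eventually.of_forall hsub)

theorem thetaIntegral_re_pos (σ : ℝ) : 0 < (thetaIntegral σ).re := by
  have h0 : ∀ n, 0 < (thetaTerm n σ).re := fun n => by
    rw [thetaTerm_ofReal_re, setIntegral_pos_iff_support_of_nonneg_ae]
    · refine lt_of_lt_of_le ?_ (measure_mono (s := Ioi (1 : ℝ)) fun x hx => ?_)
      · simp
      · have hx1 : 1 < x := hx
        refine ⟨?_, hx⟩
        simp only [Function.mem_support]
        positivity
    · refine (ae_restrict_iff' measurableSet_Ioi).2 (ae_of_all _ fun x hx => ?_)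
      have hx1 : 1 < x := hx
      simp only [Pi.zero_apply]
      positivity
    · exact integrableOn_rpow_mul_exp _ (thetaExponent_pos n)
  exact lt_of_lt_of_le (h0 0)
    (le_hasSum (Complex.hasSum_re (hasSum_thetaTerm σ)) 0 fun n _ => (h0 n).le)

theorem thetaBound_le {σ A : ℝ} {k : ℝ} (hk : 0 < k)
    (h : ∀ x : ℝ, 1 < x → x ^ (σ / 2 - 1) * Real.exp (-3 * x) ≤ A * Real.exp (-k * x)) :
    thetaBound σ ≤ A * (Real.exp (-k) / k) := by
  have h1 := integral_exp_mul_Ioi (a := -k) (by linarith) 1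
  have h2 : A * (Real.exp (-k) / k) = ∫ x in Ioi (1 : ℝ), A * Real.exp (-k * x) := by
    rw [integral_const_mul, h1]
    simp [neg_div_neg_eq]
  rw [h2]
  refine setIntegral_mono_on (integrableOn_rpow_mul_exp _ three_pos) ?_ measurableSet_Ioi
    fun x hx => h x hx
  exact (integrableOn_exp_mul_Ioi (by linarith) 1).const_mul A

theorem thetaBound_le_of_le_two {σ : ℝ} (h : σ ≤ 2) : thetaBound σ ≤ 1 / 60 := by
  refine (thetaBound_le (A := 1) three_pos fun x hx => ?_).trans ?_
  · gcongr
    exact Real.rpow_le_one_of_one_le_of_nonpos hx.le (by linarith)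
  · linarith [exp_neg_three_le]

/-- `log y ≤ y - 1` is applied at `x / a` and at `√a`; the latter produces the exponent `a^{3/2}`
instead of `a log a`. -/
theorem rpow_le_exp {x a : ℝ} (hx : 0 < x) (ha : 0 < a) :
    x ^ a ≤ Real.exp x * Real.exp (2 * (a * √a)) := by
  rw [← Real.exp_add, Real.rpow_def_of_pos hx, Real.exp_le_exp]
  have h1 := Real.log_le_sub_one_of_pos (div_pos hx ha)
  rw [Real.log_div hx.ne' ha.ne'] at h1
  have h2 := Real.log_le_sub_one_of_pos (Real.sqrt_pos.2 ha)
  rw [Real.log_sqrt ha.le] at h2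
  have h3 : a * (x / a) = x := by field_simp
  nlinarith [mul_le_mul_of_nonneg_left h1 ha.le, mul_le_mul_of_nonneg_left h2 ha.le]

theorem thetaBound_le_exp {σ R : ℝ} (h : σ ≤ R) (hR : 0 ≤ R) :
    thetaBound σ ≤ 1 / 2 * Real.exp (2 * ((1 + R) * √(1 + R))) := by
  refine (thetaBound_le (A := Real.exp (2 * ((1 + R) * √(1 + R)))) two_pos fun x hx => ?_).trans ?_
  · calc x ^ (σ / 2 - 1) * Real.exp (-3 * x) ≤ x ^ (1 + R) * Real.exp (-3 * x) := by
          gcongr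
          · exact hx.le
          · linarith
      _ ≤ Real.exp x * Real.exp (2 * ((1 + R) * √(1 + R))) * Real.exp (-3 * x) := by
          gcongr
          exact rpow_le_exp (by linarith) (by linarith)
      _ = _ := by
          rw [mul_right_comm, ← Real.exp_add, mul_comm]
          congr 2
          ring
  · have : Real.exp (-2) ≤ 1 := Real.exp_le_one_iff.2 (by norm_num)
    rw [mul_comm]
    gcongr

end ThetaIntegral

/-! ### The completed zeta function as `Λ(s) + Λ(1 - s)`. -/

section CompletedZeta

theorem evenKernel_zero_eq_theta (x : ℝ) :
    ((HurwitzZeta.evenKernel 0 x : ℝ) : ℂ) = theta (x : ℂ) := by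
  have h := HurwitzZeta.evenKernel_def 0 x
  simp only [AddCircle.coe_zero, Complex.ofReal_zero] at h
  rw [h, theta, jacobiTheta_eq_jacobiTheta₂]
  simp

/-- The function `θ - 1` cut off to `(1, ∞)`. -/
noncomputable def thetaCut : ℝ → ℂ :=
  (Ioi 1).indicator fun x => ((HurwitzZeta.evenKernel 0 x : ℝ) : ℂ) - 1

theorem locallyIntegrableOn_thetaCut : LocallyIntegrableOn thetaCut (Ioi 0) := by
  have h : LocallyIntegrableOn (fun x => ((HurwitzZeta.evenKernel 0 x : ℝ) : ℂ) - 1) (Ioi 0) :=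
    ((HurwitzZeta.hurwitzEvenFEPair 0).hf_int).sub (locallyIntegrableOn_const _)
  intro x hx
  obtain ⟨s, hs, hs'⟩ := h x hx
  exact ⟨s, hs, hs'.indicator measurableSet_Ioi⟩

theorem exists_isBigO_thetaCut :
    ∃ p : ℝ, 0 < p ∧ thetaCut =O[atTop] fun x => Real.exp (-p * x) := by
  obtain ⟨p, hp, h⟩ := HurwitzZeta.isBigO_atTop_evenKernel_sub 0
  refine ⟨p, hp, Asymptotics.IsBigO.trans (Asymptotics.IsBigO.of_bound 1 ?_) h⟩
  refine Eventually.of_forall fun x => ?_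
  rw [one_mul, thetaCut]
  refine (norm_indicator_le_norm_self _ _).trans (le_of_eq ?_)
  rw [if_pos rfl, ← Complex.norm_real]
  push_cast
  rfl

theorem isBigO_thetaCut_zero (b : ℝ) : thetaCut =O[𝓝[>] 0] fun x => x ^ (-b) := by
  have : thetaCut =ᶠ[𝓝[>] 0] fun _ => 0 := by
    filter_upwards [nhdsWithin_le_nhds (eventually_lt_nhds (zero_lt_one' ℝ))] with x hx
    exact indicator_of_notMem (by simpa using hx.le) _
  exact this.trans_isBigO (Asymptotics.isBigO_zero _ _)

theorem mellinConvergent_thetaCut (s : ℂ) : MellinConvergent thetaCut s := by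
  obtain ⟨p, hp, h⟩ := exists_isBigO_thetaCut
  exact mellinConvergent_of_isBigO_rpow_exp hp locallyIntegrableOn_thetaCut h
    (isBigO_thetaCut_zero (s.re - 1)) (by linarith)

theorem differentiable_mellin_thetaCut : Differentiable ℂ (mellin thetaCut) := by
  obtain ⟨p, hp, h⟩ := exists_isBigO_thetaCut
  exact fun s => mellin_differentiableAt_of_isBigO_rpow_exp hp locallyIntegrableOn_thetaCut h
    (isBigO_thetaCut_zero (s.re - 1)) (by linarith)

theorem thetaIntegral_eq_mellin (s : ℂ) : thetaIntegral s = mellin thetaCut (s / 2) / 2 := by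
  rw [thetaIntegral_eq, mellin, ← integral_div]
  have h : (fun x : ℝ => (x : ℂ) ^ (s / 2 - 1) • thetaCut x / 2) = (Ioi 1).indicator
      (fun x : ℝ => (x : ℂ) ^ (s / 2 - 1) * ((theta (x : ℂ) - 1) / 2)) := by
    ext x
    unfold thetaCut
    by_cases hx : x ∈ Ioi (1 : ℝ)
    · rw [indicator_of_mem hx, indicator_of_mem hx, evenKernel_zero_eq_theta, smul_eq_mul]
      ring
    · rw [indicator_of_notMem hx, indicator_of_notMem hx]
      simp
  rw [h, setIntegral_indicator measurableSet_Ioi, inter_eq_self_of_subset_right]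
  exact Ioi_subset_Ioi zero_le_one

theorem differentiable_thetaIntegral : Differentiable ℂ thetaIntegral := by
  have h : thetaIntegral = fun s => mellin thetaCut (s / 2) / 2 := funext thetaIntegral_eq_mellin
  rw [h]
  exact (differentiable_mellin_thetaCut.comp (differentiable_id.div_const 2)).div_const 2

theorem differentiable_sLam : Differentiable ℂ sLam := by
  unfold sLam
  exact (differentiable_const _).add (differentiable_id.mul differentiable_thetaIntegral)

/-- The theta functional equation moves the part on `(0, 1)` to `(1, ∞)`; both sides vanish at `x =
1`. -/
theorem f_modif_eq {x : ℝ} (hx : x ∈ Ioi (0 : ℝ)) :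
    (HurwitzZeta.hurwitzEvenFEPair 0).f_modif x
      = thetaCut x + (x : ℂ) ^ (-(1 / 2) : ℂ) • thetaCut x⁻¹ := by
  have hx0 : 0 < x := hx
  simp only [WeakFEPair.f_modif, HurwitzZeta.hurwitzEvenFEPair, Pi.add_apply, if_true, one_mul,
    Function.comp_apply, smul_eq_mul, mul_one, thetaCut]
  congr 1
  by_cases h1 : x < 1
  · rw [indicator_of_mem (show x ∈ Ioo (0 : ℝ) 1 from ⟨hx0, h1⟩),
      indicator_of_mem (show x⁻¹ ∈ Ioi (1 : ℝ) from (one_lt_inv₀ hx0).2 h1),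
      HurwitzZeta.evenKernel_functional_equation, ← HurwitzZeta.evenKernel_eq_cosKernel_of_zero,
      one_div x, Real.rpow_neg hx0.le, mul_sub, mul_one, one_div]
    have : (x : ℂ) ^ (-(1 / 2) : ℂ) = (((x ^ (1 / 2 : ℝ))⁻¹ : ℝ) : ℂ) := by
      rw [← Real.rpow_neg hx0.le, Complex.ofReal_cpow hx0.le]
      push_cast
      rfl
    rw [this]
    push_cast
    simp
  · rw [indicator_of_notMem (fun h => h1 h.2), indicator_of_notMem (by
      simp only [mem_Ioi, not_lt]
      exact inv_le_one_of_one_le₀ (not_lt.1 h1)), mul_zero]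

theorem completedRiemannZeta₀_eq (s : ℂ) :
    completedRiemannZeta₀ s = thetaIntegral s + thetaIntegral (1 - s) := by
  have h1 : MellinConvergent (fun x : ℝ => (x : ℂ) ^ (-(1 / 2) : ℂ) • thetaCut x⁻¹) (s / 2) := by
    refine MellinConvergent.cpow_smul.2 ?_
    have := (MellinConvergent.comp_rpow (f := thetaCut) (s := s / 2 + -(1 / 2))
      (a := -1) (by norm_num)).2 (mellinConvergent_thetaCut _)
    simpa only [Real.rpow_neg_one] using this
  have h2 := (hasMellin_add (mellinConvergent_thetaCut (s / 2)) h1).2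
  have h3 : completedRiemannZeta₀ s
      = mellin (HurwitzZeta.hurwitzEvenFEPair 0).f_modif (s / 2) / 2 := rfl
  rw [h3, thetaIntegral_eq_mellin, thetaIntegral_eq_mellin, ← add_div]
  congr 1
  have h4 : mellin (HurwitzZeta.hurwitzEvenFEPair 0).f_modif (s / 2)
      = mellin (fun x : ℝ => thetaCut x + (x : ℂ) ^ (-(1 / 2) : ℂ) • thetaCut x⁻¹) (s / 2) :=
    setIntegral_congr_fun measurableSet_Ioi fun x hx => by
      simp only [f_modif_eq hx]
  rw [h4, h2, mellin_cpow_smul, mellin_comp_inv]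
  -- What remains is that inversion and the weight `x^{-1/2}` replace `s / 2` by `(1 - s) / 2`.
  congr 2
  ring

theorem completedRiemannZeta_eq_Lam (s : ℂ) :
    completedRiemannZeta s = Lam s + Lam (1 - s) := by
  rw [completedRiemannZeta_eq, completedRiemannZeta₀_eq, Lam, Lam]
  ring

theorem Lam_conj (s : ℂ) : Lam (starRingEnd ℂ s) = starRingEnd ℂ (Lam s) := by
  simp [Lam, thetaIntegral_conj]

theorem sLam_conj (s : ℂ) : sLam (starRingEnd ℂ s) = starRingEnd ℂ (sLam s) := by
  simp [sLam, thetaIntegral_conj]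

theorem crit_re (t : ℝ) : (crit t).re = 1 / 2 := by simp [crit]

theorem crit_im (t : ℝ) : (crit t).im = t := by simp [crit]

theorem crit_neg (t : ℝ) : crit (-t) = starRingEnd ℂ (crit t) := by
  apply Complex.ext <;> simp [crit]

theorem crit_ne_zero (t : ℝ) : crit t ≠ 0 := fun h => by
  have := crit_re t
  rw [h] at this
  norm_num at this

theorem Gammaℝ_crit_ne_zero (t : ℝ) : Complex.Gammaℝ (crit t) ≠ 0 :=
  Complex.Gammaℝ_ne_zero_of_re_pos (by rw [crit_re]; norm_num)

theorem Z_eq (t : ℝ) :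
    Z t = ((2 * (Lam (crit t)).re / ‖Complex.Gammaℝ (crit t)‖ : ℝ) : ℂ) := by
  have h1 : 1 - crit t = starRingEnd ℂ (crit t) := by
    apply Complex.ext
    · simp [crit]
      norm_num
    · simp [crit]
  have h2 : completedRiemannZeta (crit t) = ((2 * (Lam (crit t)).re : ℝ) : ℂ) := by
    rw [completedRiemannZeta_eq_Lam, h1, Lam_conj, Complex.add_conj]
  rw [Z, riemannZeta_def_of_ne_zero (crit_ne_zero t), h2]
  have := Gammaℝ_crit_ne_zero t
  push_cast
  field_simp

end CompletedZeta

/-! ### The sign of `Im Λ`, the argument of `Λ`, and the factor `u`. -/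

section Argument

theorem Lam_re (s : ℂ) : (Lam s).re = -s.re / Complex.normSq s + (thetaIntegral s).re := by
  simp [Lam, Complex.div_re]

theorem Lam_im (s : ℂ) : (Lam s).im = s.im / Complex.normSq s + (thetaIntegral s).im := by
  simp [Lam, neg_div]

theorem Lam_im_pos {s : ℂ} (hs : 0 < s.im) (hre : s.re ≤ 6) : 0 < (Lam s).im := by
  rw [Lam_im]
  have h1 := thetaIntegral_im_nonneg hs hre
  have h2 : 0 < Complex.normSq s := Complex.normSq_pos.2 fun h => by simp [h] at hs
  positivity

theorem sLam_ne_zero_of_im_pos {s : ℂ} (hs : 0 < s.im) (hre : s.re ≤ 6) : sLam s ≠ 0 := by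
  have h0 : s ≠ 0 := fun h => by simp [h] at hs
  rw [sLam_eq h0]
  refine mul_ne_zero h0 fun h => ?_
  have := Lam_im_pos hs hre
  rw [h] at this
  exact lt_irrefl _ this

/-- For `σ ≤ 0` both summands are nonpositive; for `0 < σ ≤ 1` the integral is at most `20/19 ·
1/60`. -/
theorem re_sLam_neg {σ : ℝ} (h : σ ≤ 1) : (sLam σ).re < 0 := by
  have h1 : (sLam σ).re = -1 + σ * (thetaIntegral σ).re := by
    simp [sLam]
  rw [h1]
  have h2 := thetaIntegral_re_pos σ
  rcases le_or_gt σ 0 with h0 | h0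
  · nlinarith
  · have h3 := (Complex.re_le_norm _).trans (norm_thetaIntegral_le σ)
    have h4 := thetaBound_le_of_le_two (σ := σ) (by linarith)
    simp only [Complex.ofReal_re] at h3
    nlinarith

theorem sLam_ne_zero {s : ℂ} (hre : s.re ≤ 1) : sLam s ≠ 0 := by
  rcases lt_trichotomy s.im 0 with h | h | h
  · intro h0
    refine sLam_ne_zero_of_im_pos (s := starRingEnd ℂ s) (by simpa using h)
      (by simpa using by linarith) ?_
    rw [sLam_conj, h0, map_zero]
  · have hs : s = (s.re : ℂ) := Complex.ext (by simp) (by simp [h])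
    intro h0
    have := re_sLam_neg hre
    rw [← hs, h0] at this
    exact lt_irrefl _ this
  · exact sLam_ne_zero_of_im_pos h (by linarith)

/-- The curve `-Λ` is nonreal for `t ≠ 0` and positive at `t = 0`, so the principal argument of `-Λ`
is continuous along the whole line. -/
theorem neg_Lam_crit_mem_slitPlane (t : ℝ) : -Lam (crit t) ∈ Complex.slitPlane := by
  rw [Complex.mem_slitPlane_iff]
  rcases lt_trichotomy t 0 with h | h | h
  · right
    have h1 := Lam_im_pos (s := crit (-t)) (by rw [crit_im]; linarith) (by rw [crit_re]; norm_num)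
    rw [crit_neg, Lam_conj, Complex.conj_im] at h1
    simpa using h1.ne'
  · left
    have h1 : crit t = ((1 / 2 : ℝ) : ℂ) := by simp [crit, h]
    have h2 := re_sLam_neg (σ := 1 / 2) (by norm_num)
    rw [← h1, sLam_eq (crit_ne_zero t), h1, Complex.re_ofReal_mul] at h2
    rw [h1, Complex.neg_re]
    linarith
  · right
    have h1 := Lam_im_pos (s := crit t) (by rwa [crit_im]) (by rw [crit_re]; norm_num)
    simpa using h1.ne'

/-- The continuous determination of `arg Λ(1/2 + it)` that is close to `π / 2` for large `t`. -/
noncomputable def argLam (t : ℝ) : ℝ := Real.pi + (-Lam (crit t)).arg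

theorem continuous_Lam_crit : Continuous fun t : ℝ => Lam (crit t) := by
  have h : Continuous crit := by
    unfold crit
    fun_prop
  unfold Lam
  exact (continuous_const.div h crit_ne_zero).add (differentiable_thetaIntegral.continuous.comp h)

theorem continuous_argLam : Continuous argLam := by
  refine continuous_const.add (continuous_iff_continuousAt.2 fun t => ?_)
  exact ContinuousAt.comp (f := fun t => -Lam (crit t))
    (Complex.continuousAt_arg (neg_Lam_crit_mem_slitPlane t)) continuous_Lam_crit.neg.continuousAt

theorem Lam_crit_ne_zero (t : ℝ) : Lam (crit t) ≠ 0 := by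
  simpa using Complex.slitPlane_ne_zero (neg_Lam_crit_mem_slitPlane t)

theorem argLam_polar (t : ℝ) :
    Lam (crit t) = (‖Lam (crit t)‖ : ℂ) * Complex.exp ((argLam t : ℂ) * Complex.I) := by
  have h := Complex.norm_mul_exp_arg_mul_I (-Lam (crit t))
  rw [argLam, Complex.ofReal_add, add_mul, Complex.exp_add, Complex.exp_pi_mul_I]
  rw [norm_neg] at h
  linear_combination h

theorem argLam_of_pos {t : ℝ} (ht : 0 < t) : argLam t = (Lam (crit t)).arg := by
  have h1 := Lam_im_pos (s := crit t) (by rwa [crit_im]) (by rw [crit_re]; norm_num)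
  rw [argLam, Complex.arg_neg_eq_arg_sub_pi_of_im_pos h1]
  ring

theorem argLam_zero : argLam 0 = Real.pi := by
  have h1 : crit 0 = ((1 / 2 : ℝ) : ℂ) := by simp [crit]
  have h2 := neg_Lam_crit_mem_slitPlane 0
  have h3 : -Lam (crit 0) = ((-Lam (crit 0)).re : ℂ) := by
    rw [h1, eq_comm, ← Complex.conj_eq_iff_re]
    rw [map_neg, ← Lam_conj, Complex.conj_ofReal]
  rw [h3, Complex.ofReal_mem_slitPlane] at h2
  rw [argLam, h3, Complex.arg_ofReal_of_nonneg h2.le, add_zero]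

theorem abs_argLam_sub_lt {t : ℝ} (ht : 0 < t) : |argLam t - Real.pi / 2| < Real.pi / 2 := by
  have h1 := Lam_im_pos (s := crit t) (by rwa [crit_im]) (by rw [crit_re]; norm_num)
  rw [argLam_of_pos ht, abs_sub_lt_iff]
  have h2 : 0 < (Lam (crit t)).arg :=
    lt_of_le_of_ne (Complex.arg_nonneg_iff.2 h1.le) fun h => by
      rw [eq_comm, Complex.arg_eq_zero_iff] at h
      exact h1.ne' h.2
  have h3 : (Lam (crit t)).arg < Real.pi := Complex.arg_lt_pi_iff.2 (Or.inr h1.ne')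
  constructor <;> linarith

theorem abs_argLam_sub_le_div {t : ℝ} (ht : 0 < t) :
    |argLam t - Real.pi / 2| ≤ |(Lam (crit t)).re| / (Lam (crit t)).im := by
  have h1 := Lam_im_pos (s := crit t) (by rwa [crit_im]) (by rw [crit_re]; norm_num)
  have hlt := abs_lt.1 (abs_argLam_sub_lt ht)
  set x := argLam t - Real.pi / 2 with hx
  have h2 := argLam_polar t
  have hφ : argLam t = x + Real.pi / 2 := by rw [hx]; ring
  have hn : 0 < ‖Lam (crit t)‖ := norm_pos_iff.2 (Lam_crit_ne_zero t)
  have hre : (Lam (crit t)).re = -(‖Lam (crit t)‖ * Real.sin x) := by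
    have := congrArg Complex.re h2
    rwa [Complex.re_ofReal_mul, Complex.exp_ofReal_mul_I_re, hφ, Real.cos_add_pi_div_two,
      mul_neg] at this
  have him : (Lam (crit t)).im = ‖Lam (crit t)‖ * Real.cos x := by
    have := congrArg Complex.im h2
    rwa [Complex.im_ofReal_mul, Complex.exp_ofReal_mul_I_im, hφ, Real.sin_add_pi_div_two] at this
  have hcos : 0 < Real.cos x := Real.cos_pos_of_mem_Ioo ⟨hlt.1, hlt.2⟩
  -- The bound then follows from `|x| ≤ |tan x|` on `(-π/2, π/2)`.
  have h3 : |(Lam (crit t)).re| / (Lam (crit t)).im = |Real.tan x| := by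
    rw [hre, him, abs_neg, abs_mul, abs_of_pos hn, Real.tan_eq_sin_div_cos, abs_div,
      abs_of_pos hcos, mul_div_mul_left _ _ hn.ne']
  rw [h3]
  rcases le_total 0 x with h0 | h0
  · exact (abs_of_nonneg h0).le.trans ((Real.le_tan h0 hlt.2).trans (le_abs_self _))
  · have := Real.le_tan (neg_nonneg.2 h0) (by linarith)
    rw [Real.tan_neg] at this
    rw [abs_of_nonpos h0]
    exact this.trans (neg_le_abs _)

theorem abs_argLam_sub_lt_of_lt {t : ℝ} (ht : 10 < t) : |argLam t - Real.pi / 2| < 0.19 := by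
  have hre : (crit t).re ≤ 6 := by rw [crit_re]; norm_num
  have him : 0 < (crit t).im := by rw [crit_im]; linarith
  have hN : Complex.normSq (crit t) = 1 / 4 + t ^ 2 := by
    rw [Complex.normSq_apply, crit_re, crit_im]
    ring
  refine (abs_argLam_sub_le_div (by linarith)).trans_lt ?_
  rw [div_lt_iff₀ (Lam_im_pos him hre), Lam_re, Lam_im, hN, crit_re, crit_im]
  have h1 := abs_re_thetaIntegral_le him hre
  have h2 := thetaIntegral_im_nonneg him hre
  rw [crit_im] at h1
  have h3 : |-(1 / 2) / (1 / 4 + t ^ 2) + (thetaIntegral (crit t)).re|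
      ≤ 1 / 2 / (1 / 4 + t ^ 2) + 2 / 19 / t := by
    refine (abs_add_le _ _).trans (add_le_add ?_ h1)
    rw [neg_div, abs_neg, abs_of_pos (by positivity)]
  -- The two parts of `|Re Λ|` contribute `0.106` and `0.05` times the lower bound `t / (1/4 + t²)`
  -- for `Im Λ`; their sum is below `0.19`.
  have h4 : 2 / 19 / t ≤ 0.106 * (t / (1 / 4 + t ^ 2)) := by
    rw [div_div, ← mul_div_assoc, div_le_div_iff₀ (by linarith) (by positivity)]
    nlinarith
  have h5 : 1 / 2 / (1 / 4 + t ^ 2) ≤ 0.05 * (t / (1 / 4 + t ^ 2)) := by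
    rw [← mul_div_assoc]
    gcongr
    linarith
  have h6 : 0 < t / (1 / 4 + t ^ 2) := by
    have : 0 < t := by linarith
    positivity
  nlinarith

theorem isArgLam_argLam : IsArgLam argLam where
  continuous := continuous_argLam
  ne_zero := Lam_crit_ne_zero
  polar := argLam_polar
  near _ := abs_argLam_sub_lt_of_lt

/-- The positive factor `u(t)` in `Z(t) = u(t) (π / 2 - arg Λ(1/2 + it))`. -/
noncomputable def zFactor (t : ℝ) : ℝ :=
  2 * ‖Lam (crit t)‖ / ‖Complex.Gammaℝ (crit t)‖ * Real.sinc (Real.pi / 2 - argLam t)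

theorem zFactor_pos {t : ℝ} (ht : 0 < t) : 0 < zFactor t := by
  have h1 : 0 < ‖Lam (crit t)‖ := norm_pos_iff.2 (Lam_crit_ne_zero t)
  have h2 : 0 < ‖Complex.Gammaℝ (crit t)‖ := norm_pos_iff.2 (Gammaℝ_crit_ne_zero t)
  have h3 := abs_lt.1 (abs_argLam_sub_lt ht)
  have h4 : 0 < Real.sinc (Real.pi / 2 - argLam t) := by
    set x := Real.pi / 2 - argLam t with hx
    have hx1 : x < Real.pi := by linarith
    have hx2 : -Real.pi < x := by linarith
    rcases lt_trichotomy x 0 with h | h | h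
    · rw [Real.sinc_of_ne_zero h.ne]
      exact div_pos_of_neg_of_neg (Real.sin_neg_of_neg_of_neg_pi_lt h hx2) h
    · rw [h, Real.sinc_zero]
      exact one_pos
    · rw [Real.sinc_of_ne_zero h.ne']
      exact div_pos (Real.sin_pos_of_pos_of_lt_pi h hx1) h
  unfold zFactor
  positivity

/-- `sinc` removes the division by `π/2 - argLam t`, so the identity also holds where that
difference vanishes. -/
theorem Z_eq_zFactor_mul (t : ℝ) :
    Z t = ((zFactor t * (Real.pi / 2 - argLam t) : ℝ) : ℂ) := by
  have h1 : Real.sinc (Real.pi / 2 - argLam t) * (Real.pi / 2 - argLam t)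
      = Real.sin (Real.pi / 2 - argLam t) := by
    by_cases h : Real.pi / 2 - argLam t = 0
    · simp [h]
    · rw [Real.sinc_of_ne_zero h, div_mul_cancel₀ _ h]
  have h2 : (Lam (crit t)).re = ‖Lam (crit t)‖ * Real.cos (argLam t) := by
    have := congrArg Complex.re (argLam_polar t)
    rwa [Complex.re_ofReal_mul, Complex.exp_ofReal_mul_I_re] at this
  rw [Z_eq, zFactor, mul_assoc, h1, Real.sin_pi_div_two_sub, h2]
  congr 1
  ring

end Argument

/-! ### Listing zeros with multiplicity. -/

section ZeroSet

theorem encard_setOf_natCast_lt (m : ℕ∞) : {k : ℕ | (k : ℕ∞) < m}.encard = m := by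
  induction m with
  | top => simp
  | coe n =>
    have : {k : ℕ | (k : ℕ∞) < (n : ℕ∞)} = (Finset.range n : Set ℕ) := by
      ext k
      simp
    rw [this, Set.encard_coe_eq_coe_finsetCard, Finset.card_range]

/-- Pairs `(z, k)` with `P z` and `k` less than the order of vanishing of `f` at `z`; they list the
zeros of `f` in `P` with multiplicity. -/
def ZeroIndex (f : ℂ → ℂ) (P : ℂ → Prop) : Set (ℂ × ℕ) :=
  {p | P p.1 ∧ (p.2 : ℕ∞) < analyticOrderAt f p.1}

theorem encard_zeroIndex (f : ℂ → ℂ) {P : ℂ → Prop} {z : ℂ} (hz : P z) :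
    {i : ZeroIndex f P | i.1.1 = z}.encard = analyticOrderAt f z := by
  rw [← encard_setOf_natCast_lt (analyticOrderAt f z)]
  refine Set.encard_congr ⟨fun i => ⟨i.1.1.2, ?_⟩, fun k => ⟨⟨(z, k.1), hz, k.2⟩, rfl⟩, ?_, ?_⟩
  · have := i.1.2.2
    rwa [i.2] at this
  · rintro ⟨⟨⟨w, k⟩, hw⟩, hz⟩
    simp only [mem_ofPred_eq] at hz
    subst hz
    rfl
  · rintro ⟨k, hk⟩
    rfl

/-- Ties in `v` are broken by an injection into `ℕ`. Each element then has finitely many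
predecessors, and their number is an injective rank whose infinite range in `ℕ` is order isomorphic
to `ℕ`. -/
theorem exists_monotone_enumeration {S : Type*} [Infinite S] (v : S → ℝ)
    (hv : ∀ R, {i | v i ≤ R}.Finite) : ∃ e : ℕ ≃ S, Monotone fun n => v (e n) := by
  have hc : Countable S := by
    rw [← Set.countable_univ_iff]
    have : (univ : Set S) = ⋃ n : ℕ, {i | v i ≤ n} := by
      ext i
      simpa using exists_nat_ge (v i)
    rw [this]
    exact Set.countable_iUnion fun n => (hv n).countable
  obtain ⟨c, hcinj⟩ := hc.exists_injective_nat
  let L : S → ℝ ×ₗ ℕ := fun i => toLex (v i, c i)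
  have hL : Function.Injective L := fun i j h => hcinj (by
    have := congrArg (fun p => (ofLex p).2) h
    simpa [L] using this)
  have hLv : ∀ i j, L i ≤ L j → v i ≤ v j := fun i j h => by
    rcases (Prod.Lex.toLex_le_toLex.1 h) with h | h
    · exact h.le
    · exact h.1.le
  let r : S → ℕ := fun i => {j | L j < L i}.ncard
  have hfin : ∀ i, {j | L j < L i}.Finite := fun i =>
    (hv (v i)).subset fun j hj => hLv j i (le_of_lt hj)
  have hr : ∀ i j, L i < L j → r i < r j := fun i j h =>
    Set.ncard_lt_ncard ⟨fun k hk => lt_trans hk h, fun h' => lt_irrefl (L i) (h' h)⟩ (hfin j)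
  have hrinj : Function.Injective r := fun i j h => by
    rcases lt_trichotomy (L i) (L j) with h1 | h1 | h1
    · exact absurd h (hr _ _ h1).ne
    · exact hL h1
    · exact absurd h (hr _ _ h1).ne'
  have : Infinite (range r) := Set.infinite_coe_iff.2 (Set.infinite_range_of_injective hrinj)
  classical
  let o := Nat.Subtype.orderIsoOfNat (range r)
  let e : ℕ ≃ S := o.toEquiv.trans (Equiv.ofInjective r hrinj).symm
  have hre : ∀ n, r (e n) = o n := fun n =>
    congrArg Subtype.val ((Equiv.ofInjective r hrinj).apply_symm_apply (o n))
  refine ⟨e, fun m n hmn => hLv _ _ (not_lt.1 fun h => ?_)⟩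
  have h1 := hr _ _ h
  rw [hre, hre] at h1
  exact absurd (o.monotone hmn) (not_le.2 h1)

/-- A factorization at `z` is reflected to one at the conjugate point by `w ↦ conj (g (conj w))`. -/
theorem le_analyticOrderAt_conj {f : ℂ → ℂ} (hf : Differentiable ℂ f)
    (hconj : ∀ s, f (starRingEnd ℂ s) = starRingEnd ℂ (f s)) (z : ℂ) :
    analyticOrderAt f z ≤ analyticOrderAt f (starRingEnd ℂ z) := by
  refine ENat.forall_natCast_le_iff_le.1 fun n hn => ?_
  rw [natCast_le_analyticOrderAt (hf.analyticAt _)] at hn ⊢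
  obtain ⟨g, hg, hfg⟩ := hn
  have hcont : Tendsto (starRingEnd ℂ) (𝓝 (starRingEnd ℂ z)) (𝓝 z) := by
    simpa using Complex.continuous_conj.tendsto (starRingEnd ℂ z)
  refine ⟨fun w => starRingEnd ℂ (g (starRingEnd ℂ w)), ?_, ?_⟩
  · rw [Complex.analyticAt_iff_eventually_differentiableAt] at hg ⊢
    filter_upwards [hcont.eventually hg] with w hw
    simpa [Function.comp_def] using hw.conj_conj
  · filter_upwards [hcont.eventually hfg] with w hw
    have := congrArg (starRingEnd ℂ) hw
    rw [hconj] at this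
    simpa using this

theorem analyticOrderAt_conj {f : ℂ → ℂ} (hf : Differentiable ℂ f)
    (hconj : ∀ s, f (starRingEnd ℂ s) = starRingEnd ℂ (f s)) (z : ℂ) :
    analyticOrderAt f (starRingEnd ℂ z) = analyticOrderAt f z :=
  le_antisymm (by simpa using le_analyticOrderAt_conj hf hconj (starRingEnd ℂ z))
    (le_analyticOrderAt_conj hf hconj z)

end ZeroSet

/-! ### Growth of `sΛ(s)` and the count of its zeros. -/

section Growth

/-- The exponent `3 (1 + R) ^ (3 / 2)` in the growth bound for `s Λ(s)`. -/
noncomputable def growthExponent (R : ℝ) : ℝ := 3 * ((1 + R) * √(1 + R))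

theorem norm_sLam_le (s : ℂ) : ‖sLam s‖ ≤ Real.exp (growthExponent ‖s‖) := by
  have hR := norm_nonneg s
  set R := ‖s‖ with hRdef
  set y := (1 + R) * √(1 + R) with hy
  have h1 : ‖thetaIntegral s‖ ≤ Real.exp (2 * y) := by
    have h2 := norm_thetaIntegral_le s
    have h3 := thetaBound_le_exp (σ := s.re) (Complex.re_le_norm s) hR
    have h4 := Real.exp_pos (2 * y)
    linarith
  have h2 : 1 + R ≤ y := le_mul_of_one_le_right (by linarith) (Real.one_le_sqrt.2 (by linarith))
  have h3 : 1 ≤ Real.exp (2 * y) := Real.one_le_exp (by linarith)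
  calc ‖sLam s‖ ≤ ‖(-1 : ℂ)‖ + ‖s * thetaIntegral s‖ := norm_add_le _ _
    _ ≤ 1 * Real.exp (2 * y) + R * Real.exp (2 * y) := by
        rw [norm_neg, norm_one, norm_mul]
        gcongr
        linarith
    _ = (R + 1) * Real.exp (2 * y) := by ring
    _ ≤ Real.exp y * Real.exp (2 * y) := by
        gcongr
        exact (Real.add_one_le_exp R).trans (Real.exp_le_exp.2 (by linarith))
    _ = _ := by
        rw [← Real.exp_add, growthExponent]
        congr 1
        ring

theorem growthExponent_pos {R : ℝ} (hR : 0 ≤ R) : 0 < growthExponent R := by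
  unfold growthExponent
  positivity

theorem tendsto_growthExponent :
    Tendsto (fun R : ℝ => growthExponent (2 * R) / R ^ 2) atTop (𝓝 0) := by
  have h1 : Tendsto (fun R : ℝ => 18 / √R) atTop (𝓝 0) :=
    Tendsto.const_div_atTop Real.tendsto_sqrt_atTop 18
  refine squeeze_zero' ?_ ?_ h1
  · filter_upwards [eventually_ge_atTop 0] with R hR
    have := growthExponent_pos (R := 2 * R) (by positivity)
    positivity
  · filter_upwards [eventually_ge_atTop 1] with R hR
    have hR0 : 0 < R := by linarith
    have h2 : √(1 + 2 * R) ≤ 2 * √R := by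
      rw [Real.sqrt_le_left (by positivity), mul_pow, Real.sq_sqrt hR0.le]
      linarith
    have h3 : 0 < √R := Real.sqrt_pos.2 hR0
    rw [div_le_div_iff₀ (by positivity) h3]
    unfold growthExponent
    calc 3 * ((1 + 2 * R) * √(1 + 2 * R)) * √R ≤ 3 * ((3 * R) * (2 * √R)) * √R := by
          gcongr
          linarith
      _ = 18 * R * (√R * √R) := by ring
      _ = _ := by
          rw [Real.mul_self_sqrt hR0.le]
          ring

theorem differentiable_neg_sLam : Differentiable ℂ (-sLam) := differentiable_sLam.neg

theorem norm_neg_sLam_le (s : ℂ) : ‖(-sLam) s‖ ≤ Real.exp (growthExponent ‖s‖) := by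
  rw [Pi.neg_apply, norm_neg]
  exact norm_sLam_le s

theorem neg_sLam_zero : (-sLam) 0 = 1 := by
  rw [Pi.neg_apply, sLam_zero, neg_neg]

theorem hasDerivAt_sLam (s : ℂ) :
    HasDerivAt sLam (thetaIntegral s + s * deriv thetaIntegral s) s :=
  (((hasDerivAt_id s).fun_mul (differentiable_thetaIntegral s).hasDerivAt).const_add
    (-1)).congr_deriv (by simp)

theorem deriv_neg_sLam_zero : deriv (-sLam) 0 = -thetaIntegral 0 := by
  simpa using (hasDerivAt_sLam 0).neg.deriv

theorem hasProd_neg_sLam {ι : Type*} {b : ι → ℂ}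
    (hb : ∀ z, {i | b i = z}.encard = analyticOrderAt sLam z)
    (hs : Summable fun i => (‖b i‖ ^ 2)⁻¹) (s : ℂ) :
    HasProd (fun i => (1 - s / b i) * Complex.exp (s / b i))
      (-sLam s * Complex.exp (thetaIntegral 0 * s)) := by
  have h := hasProd_genus_one differentiable_neg_sLam neg_sLam_zero
    (fun z => by rw [hb, analyticOrderAt_neg]) hs norm_neg_sLam_le
    ((eventually_ge_atTop 0).mono fun R hR => growthExponent_pos (by positivity))
    tendsto_growthExponent s
  simpa [deriv_neg_sLam_zero] using h

theorem log_two_mul_card_le {ι : Type*} {b : ι → ℂ}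
    (hb : ∀ z, {i | b i = z}.encard = analyticOrderAt sLam z) {R : ℝ} (hR : 0 < R)
    (T : Finset ι) (hT : ∀ i ∈ T, ‖b i‖ ≤ R) :
    T.card * Real.log 2 ≤ growthExponent (3 * R) := by
  have h := two_pow_card_le differentiable_neg_sLam neg_sLam_zero
    (fun z => by rw [hb, analyticOrderAt_neg]) hR
    (fun s hs => hs ▸ norm_neg_sLam_le s) T hT
  rw [← Real.log_pow]
  exact (Real.log_le_iff_le_exp (by positivity)).2 h

theorem finite_zeros_norm_le {ι : Type*} {b : ι → ℂ}
    (hb : ∀ z, {i | b i = z}.encard = analyticOrderAt sLam z) (R : ℝ) :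
    {i | ‖b i‖ ≤ R}.Finite := by
  by_contra hinf
  obtain ⟨n, hn⟩ := exists_nat_gt (growthExponent (3 * max R 1) / Real.log 2)
  obtain ⟨T, hT, hcard⟩ := Set.Infinite.exists_subset_card_eq hinf n
  have h := log_two_mul_card_le hb (R := max R 1) (by positivity) T
    fun i hi => (hT hi).trans (le_max_left _ _)
  rw [hcard] at h
  rw [div_lt_iff₀ (Real.log_pos one_lt_two)] at hn
  linarith

end Growth

/-! ### The unique, simple real zero. -/

section RealZero

theorem re_sLam_ofReal (σ : ℝ) : (sLam σ).re = -1 + σ * (thetaIntegral σ).re := by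
  simp [sLam]

theorem sLam_ofReal (σ : ℝ) : sLam σ = ((sLam σ).re : ℂ) := by
  have h := sLam_conj σ
  rw [Complex.conj_ofReal] at h
  exact (Complex.conj_eq_iff_re.1 h.symm).symm

theorem exists_real_zero : ∃ β : ℝ, sLam β = 0 := by
  have hα := thetaIntegral_re_pos 0
  set α := (thetaIntegral (0 : ℝ)).re with hαdef
  have hcont : Continuous fun σ : ℝ => (sLam σ).re :=
    Complex.continuous_re.comp (differentiable_sLam.continuous.comp Complex.continuous_ofReal)
  -- At `σ = 1 / α` monotonicity of the integral gives `σ thetaIntegral σ ≥ σ α = 1`.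
  have h1 : (sLam ((1 / α : ℝ) : ℂ)).re ≥ 0 := by
    rw [re_sLam_ofReal]
    have h2 := thetaIntegral_re_mono (σ := 0) (σ' := 1 / α) (by positivity)
    have h3 : 1 / α * α = 1 := by field_simp
    have h4 : 0 < 1 / α := by positivity
    nlinarith [mul_le_mul_of_nonneg_left h2 h4.le]
  obtain ⟨β, hβ⟩ := mem_range_of_exists_le_of_exists_ge hcont
    ⟨0, (re_sLam_neg zero_le_one).le⟩ ⟨1 / α, h1⟩
  exact ⟨β, by
    rw [sLam_ofReal]
    simpa using hβ⟩

theorem one_lt_re_of_sLam_eq_zero {z : ℂ} (h : sLam z = 0) : 1 < z.re := by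
  by_contra hcon
  exact sLam_ne_zero (not_lt.1 hcon) h

theorem real_zero_unique {β γ : ℝ} (hβ : sLam β = 0) (hγ : sLam γ = 0) : β = γ := by
  wlog h : β < γ generalizing β γ
  · rcases (not_lt.1 h).eq_or_lt with h' | h'
    · exact h'.symm
    · exact (this hγ hβ h').symm
  exfalso
  have h1 := one_lt_re_of_sLam_eq_zero hβ
  have h2 := congrArg Complex.re hβ
  have h3 := congrArg Complex.re hγ
  rw [re_sLam_ofReal, Complex.zero_re] at h2 h3
  rw [Complex.ofReal_re] at h1
  have h4 := thetaIntegral_re_mono h.le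
  have h5 := thetaIntegral_re_pos β
  nlinarith

theorem deriv_sLam_ne_zero {β : ℝ} (hβ : sLam β = 0) : deriv sLam β ≠ 0 := by
  have h1 := one_lt_re_of_sLam_eq_zero hβ
  rw [Complex.ofReal_re] at h1
  have hd := (differentiable_thetaIntegral (β : ℂ)).hasDerivAt
  have h3 : 0 ≤ (deriv thetaIntegral β).re := by
    rw [← hd.real_of_complex.deriv]
    exact Monotone.deriv_nonneg fun _ _ h => thetaIntegral_re_mono h
  rw [(hasDerivAt_sLam β).deriv]
  intro h
  have h4 := congrArg Complex.re h
  rw [Complex.add_re, Complex.re_ofReal_mul, Complex.zero_re] at h4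
  have h5 := thetaIntegral_re_pos β
  have : 0 ≤ β * (deriv thetaIntegral β).re := by positivity
  linarith

theorem analyticOrderAt_real_zero {β : ℝ} (hβ : sLam β = 0) : analyticOrderAt sLam β = 1 := by
  have := (differentiable_sLam.analyticAt (β : ℂ)).analyticOrderAt_sub_eq_one_of_deriv_ne_zero
    (deriv_sLam_ne_zero hβ)
  simpa [hβ] using this

theorem analyticOrderAt_ofReal_of_ne {β x : ℝ} (hβ : sLam β = 0) (hx : β ≠ x) :
    analyticOrderAt sLam x = 0 :=
  analyticOrderAt_eq_zero.2 (Or.inr fun h => hx (real_zero_unique hβ h))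

end RealZero

/-! ### Infinitude of the zeros. -/

section Infinite

theorem norm_prod_genus_one_le {ι : Type*} [Fintype ι] (b : ι → ℂ) (s : ℂ) :
    ‖∏ i, (1 - s / b i) * Complex.exp (s / b i)‖ ≤ Real.exp (‖s‖ * ∑ i, 2 / ‖b i‖) := by
  rw [norm_prod, Finset.mul_sum, Real.exp_sum]
  refine Finset.prod_le_prod (fun _ _ => norm_nonneg _) fun i _ => ?_
  have h1 : ‖1 - s / b i‖ ≤ Real.exp (‖s / b i‖) := by
    refine (norm_sub_le _ _).trans ?_
    rw [norm_one, add_comm]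
    exact Real.add_one_le_exp _
  calc ‖(1 - s / b i) * Complex.exp (s / b i)‖
      ≤ Real.exp ‖s / b i‖ * Real.exp ‖s / b i‖ := by
        rw [norm_mul]
        gcongr
        rw [Complex.norm_exp]
        exact Real.exp_le_exp.2 (Complex.re_le_norm _)
    _ = _ := by
        rw [← Real.exp_add, norm_div]
        congr 1
        ring

theorem exists_exp_lt_sLam (C : ℝ) (hC : 0 ≤ C) :
    ∃ σ : ℝ, 0 < σ ∧ Real.exp (C * σ) < (sLam σ).re := by
  set r := Real.exp (2 * (C + 1)) with hr
  -- Chosen so that the lower bound `r^{σ/2 - 1} exp (-π (r + 1))` is exactly `exp (Cσ + 2)`.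
  set σ := 2 * (C + 1) + Real.pi * (r + 1) + 2 with hσ
  have hr1 : 1 ≤ r := Real.one_le_exp (by linarith)
  have hπ := Real.pi_pos
  have hσ2 : 2 < σ := by
    have : 0 < Real.pi * (r + 1) := by positivity
    linarith
  refine ⟨σ, by linarith, ?_⟩
  rw [re_sLam_ofReal]
  have h1 := le_thetaIntegral_re (σ := σ) hσ2.le hr1
  have h2 : r ^ (σ / 2 - 1) * Real.exp (-Real.pi * (r + 1)) = Real.exp (C * σ + 2) := by
    rw [hr, ← Real.exp_mul, ← Real.exp_add, ← hr]
    congr 1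
    rw [hσ]
    ring
  rw [h2] at h1
  have h3 : Real.exp (C * σ) ≤ Real.exp (C * σ + 2) := Real.exp_le_exp.2 (by linarith)
  have h4 : 1 < Real.exp (C * σ + 2) := Real.one_lt_exp_iff.2 (by positivity)
  nlinarith

theorem infinite_zeroIndex : Infinite (ZeroIndex sLam fun _ => True) := by
  by_contra hfin
  rw [not_infinite_iff_finite] at hfin
  have := Fintype.ofFinite (ZeroIndex sLam fun _ => True)
  set b : ZeroIndex sLam (fun _ => True) → ℂ := fun i => i.1.1 with hb
  have hα : thetaIntegral 0 = ((thetaIntegral (0 : ℝ)).re : ℂ) := by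
    rw [← thetaIntegral_ofReal]
    simp
  set α := (thetaIntegral (0 : ℝ)).re with hαdef
  obtain ⟨σ, hσ, hlt⟩ := exists_exp_lt_sLam (∑ i, 2 / ‖b i‖)
    (Finset.sum_nonneg fun i _ => by positivity)
  have h1 := (hasProd_neg_sLam (b := b) (fun z => encard_zeroIndex sLam trivial)
    (hasSum_fintype _).summable σ).unique (hasProd_fintype _)
  have h2 := norm_prod_genus_one_le b σ
  rw [← h1, norm_mul, norm_neg, Complex.norm_real, hα, ← Complex.ofReal_mul,
    Complex.norm_exp_ofReal, Real.norm_of_nonneg hσ.le] at h2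
  -- A finite product is at most `exp (Cσ)` in modulus; since `α > 0`, the Hadamard factor can only
  -- enlarge the left side and may be dropped.
  have h3 : 1 ≤ Real.exp (α * σ) :=
    Real.one_le_exp (mul_nonneg (thetaIntegral_re_pos 0).le hσ.le)
  have h4 := Complex.re_le_norm (sLam σ)
  have h5 : ‖sLam σ‖ ≤ ‖sLam σ‖ * Real.exp (α * σ) := le_mul_of_one_le_right (norm_nonneg _) h3
  rw [mul_comm σ] at h2
  linarith

/-- Conjugation matches the two half planes with multiplicity, and the real axis adds a single
simple zero. -/
theorem infinite_zeroIndex_im_pos : Infinite (ZeroIndex sLam fun z => 0 < z.im) := by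
  by_contra hfin
  rw [not_infinite_iff_finite, Set.finite_coe_iff] at hfin
  refine absurd (Set.infinite_coe_iff.1 infinite_zeroIndex) (not_not.2 ?_)
  obtain ⟨β, hβ⟩ := exists_real_zero
  refine ((hfin.union (hfin.image (Prod.map (starRingEnd ℂ) id))).union
    (Set.finite_singleton ((β : ℂ), 0))).subset ?_
  rintro ⟨z, k⟩ ⟨-, hk⟩
  simp only at hk
  rcases lt_trichotomy z.im 0 with h | h | h
  · refine Or.inl (Or.inr ⟨(starRingEnd ℂ z, k), ⟨by simpa using h, ?_⟩, by simp⟩)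
    simpa [analyticOrderAt_conj differentiable_sLam sLam_conj] using hk
  · right
    have hz : z = (z.re : ℂ) := Complex.ext (by simp) (by simp [h])
    by_cases hne : β = z.re
    · rw [hz, ← hne, analyticOrderAt_real_zero hβ] at hk
      have hk0 : k = 0 := by
        have : k < 1 := by exact_mod_cast hk
        omega
      rw [hz, ← hne, hk0]
      rfl
    · rw [hz, analyticOrderAt_ofReal_of_ne hβ hne] at hk
      simp at hk
  · exact Or.inl (Or.inl ⟨h, hk⟩)

end Infinite

/-! ### Existence of the enumeration over `ℤ`. -/

section Enumeration

/-- The enumeration over `ℤ` with `b 0 = β`, `b (k + 1) = u k` and `b (-(k + 1)) = conj (u k)`. -/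
noncomputable def conjEnumeration (β : ℝ) (u : ℕ → ℂ) : ℤ → ℂ
  | Int.ofNat 0 => β
  | Int.ofNat (k + 1) => u k
  | Int.negSucc k => starRingEnd ℂ (u k)

theorem conjEnumeration_neg (β : ℝ) (u : ℕ → ℂ) (n : ℤ) :
    conjEnumeration β u (-n) = starRingEnd ℂ (conjEnumeration β u n) := by
  match n with
  | Int.ofNat 0 => exact (Complex.conj_ofReal β).symm
  | Int.ofNat (k + 1) => rfl
  | Int.negSucc k => exact (Complex.conj_conj (u k)).symm

theorem encard_conjEnumeration_of_im_pos (β : ℝ) {u : ℕ → ℂ} (hu : ∀ k, 0 < (u k).im) {z : ℂ}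
    (hz : 0 < z.im) : {n | conjEnumeration β u n = z}.encard = {k | u k = z}.encard := by
  have hinj : Function.Injective fun k : ℕ => Int.ofNat (k + 1) := fun k l h => by simpa using h
  rw [← hinj.encard_image]
  congr 1
  ext n
  constructor
  · intro hn
    match n with
    | Int.ofNat 0 =>
      have hn' : (β : ℂ) = z := hn
      rw [← hn', Complex.ofReal_im] at hz
      exact absurd hz (lt_irrefl 0)
    | Int.ofNat (k + 1) => exact ⟨k, hn, rfl⟩
    | Int.negSucc k =>
      have hn' : starRingEnd ℂ (u k) = z := hn
      rw [← hn', Complex.conj_im] at hz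
      linarith [hu k]
  · rintro ⟨k, hk, rfl⟩
    exact hk

theorem conjEnumeration_im_eq_zero_iff (β : ℝ) {u : ℕ → ℂ} (hu : ∀ k, 0 < (u k).im) (n : ℤ) :
    (conjEnumeration β u n).im = 0 ↔ n = 0 := by
  match n with
  | Int.ofNat 0 => exact ⟨fun _ => rfl, fun _ => Complex.ofReal_im β⟩
  | Int.ofNat (k + 1) => exact ⟨fun h => absurd h (hu k).ne', fun h => by simp at h; omega⟩
  | Int.negSucc k =>
    refine ⟨fun h => absurd h ?_, fun h => by simp at h⟩
    change (starRingEnd ℂ (u k)).im ≠ 0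
    rw [Complex.conj_im, neg_ne_zero]
    exact (hu k).ne'

theorem exists_isZeroEnumeration : ∃ b : ℤ → ℂ, IsZeroEnumeration b := by
  obtain ⟨β, hβ⟩ := exists_real_zero
  have := infinite_zeroIndex_im_pos
  have hfin : ∀ R, {i : ZeroIndex sLam (fun z => 0 < z.im) | ‖i.1.1‖ ≤ R}.Finite := by
    intro R
    have h := finite_zeros_norm_le (b := fun i : ZeroIndex sLam (fun _ => True) => i.1.1)
      (fun z => encard_zeroIndex sLam trivial) R
    refine Set.Finite.of_finite_image (f := fun i => (⟨i.1, trivial, i.2.2⟩ :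
      ZeroIndex sLam (fun _ => True))) (h.subset ?_) fun i _ j _ h => ?_
    · rintro _ ⟨i, hi, rfl⟩
      exact hi
    · exact Subtype.ext (congrArg (fun p => p.1) h)
  obtain ⟨e, he⟩ := exists_monotone_enumeration _ hfin
  have hu : ∀ k, 0 < (e k).1.1.im := fun k => (e k).2.1
  refine ⟨conjEnumeration β fun k => (e k).1.1, ?_, conjEnumeration_im_eq_zero_iff β hu,
    conjEnumeration_neg β _, ?_⟩
  · have hpos : ∀ z : ℂ, 0 < z.im →
        {n | conjEnumeration β (fun k => (e k).1.1) n = z}.encard = analyticOrderAt sLam z := by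
      intro z hz
      rw [encard_conjEnumeration_of_im_pos β hu hz, ← encard_zeroIndex sLam (P := fun z => 0 < z.im) hz]
      exact Set.encard_preimage_of_bijective e.bijective
        {i : ZeroIndex sLam fun z => 0 < z.im | i.1.1 = z}
    intro z
    rcases lt_trichotomy z.im 0 with h | h | h
    · rw [← analyticOrderAt_conj differentiable_sLam sLam_conj,
        ← hpos (starRingEnd ℂ z) (by simpa using h), ← neg_injective.encard_image]
      congr 1
      ext n
      constructor
      · rintro ⟨m, hm, rfl⟩
        have hm' : conjEnumeration β (fun k => (e k).1.1) m = z := hm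
        simp only [mem_ofPred_eq]
        rw [conjEnumeration_neg, hm']
      · intro hn
        refine ⟨-n, ?_, neg_neg n⟩
        have hn' : conjEnumeration β (fun k => (e k).1.1) n = starRingEnd ℂ z := hn
        simp only [mem_ofPred_eq]
        rw [conjEnumeration_neg, hn', Complex.conj_conj]
    · have hz : z = (z.re : ℂ) := Complex.ext (by simp) (by simp [h])
      have hsub : ∀ n, conjEnumeration β (fun k => (e k).1.1) n = z → n = 0 := fun n hn =>
        (conjEnumeration_im_eq_zero_iff β hu n).1 (by rw [hn, h])
      by_cases hne : β = z.re
      · rw [hz, ← hne, analyticOrderAt_real_zero hβ, Set.encard_eq_one]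
        refine ⟨0, Set.ext fun n => ⟨fun hn => hsub n (by rw [hz, ← hne]; exact hn), ?_⟩⟩
        rintro rfl
        rfl
      · rw [hz, analyticOrderAt_ofReal_of_ne hβ hne, Set.encard_eq_zero, ← hz]
        refine Set.eq_empty_of_forall_notMem fun n hn => hne ?_
        have hn0 := hsub n hn
        subst hn0
        have hn' : (β : ℂ) = z := hn
        rw [← hn', Complex.ofReal_re]
    · exact hpos z h
  · intro n hn
    obtain ⟨k, rfl⟩ : ∃ k : ℕ, n = Int.ofNat (k + 1) :=
      ⟨n.toNat - 1, by simp only [Int.ofNat_eq_natCast]; omega⟩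
    exact he (Nat.le_succ k)

end Enumeration

/-! ### Location of the zeros and convergence of `∑ |b_n|⁻²`. -/

section Zeros

variable {b : ℤ → ℂ}

theorem IsZeroEnumeration.sLam_eq_zero (hb : IsZeroEnumeration b) (n : ℤ) : sLam (b n) = 0 := by
  refine (analyticOrderAt_ne_zero.1 ?_).2
  rw [← hb.multiplicity, Set.encard_ne_zero]
  exact ⟨n, rfl⟩

theorem IsZeroEnumeration.one_lt_re (hb : IsZeroEnumeration b) (n : ℤ) : 1 < (b n).re :=
  one_lt_re_of_sLam_eq_zero (hb.sLam_eq_zero n)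

theorem IsZeroEnumeration.one_lt_norm (hb : IsZeroEnumeration b) (n : ℤ) : 1 < ‖b n‖ :=
  (hb.one_lt_re n).trans_le (Complex.re_le_norm _)

theorem IsZeroEnumeration.ne_zero (hb : IsZeroEnumeration b) (n : ℤ) : b n ≠ 0 :=
  norm_pos_iff.1 (zero_lt_one.trans (hb.one_lt_norm n))

theorem IsZeroEnumeration.norm_mono (hb : IsZeroEnumeration b) :
    Monotone fun k : ℕ => ‖b (k + 1)‖ :=
  monotone_nat_of_le_succ fun k => by
    have := hb.ordered (k + 1) (by omega)
    simpa using this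

/-- The disc of radius `‖b (k + 1)‖` contains the `k + 1` zeros `b 1, …, b (k + 1)`, so `k + 1 =
O(R^{3/2})`. Raising to the power `4/3` gives `R²`, and `4/3 > 1` makes the majorant summable. -/
theorem IsZeroEnumeration.inv_norm_sq_le (hb : IsZeroEnumeration b) (k : ℕ) :
    (‖b (k + 1)‖ ^ 2)⁻¹ ≤ 16 * ((((k + 1 : ℕ) : ℝ) / 6) ^ (4 / 3 : ℝ))⁻¹ := by
  set R := ‖b (k + 1)‖ with hR
  have hR1 : 1 < R := hb.one_lt_norm _
  have h1 := log_two_mul_card_le hb.multiplicity (R := R) (by linarith)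
    ((Finset.range (k + 1)).image fun j : ℕ => (j : ℤ) + 1) fun i hi => by
      obtain ⟨j, hj, rfl⟩ := Finset.mem_image.1 hi
      exact hb.norm_mono (Nat.lt_succ_iff.1 (Finset.mem_range.1 hj))
  rw [Finset.card_image_of_injective _ fun i j h => by simpa using h, Finset.card_range] at h1
  set y := √(1 + 3 * R) with hy
  have hy0 : 0 ≤ y := Real.sqrt_nonneg _
  have hy2 : y ^ 2 = 1 + 3 * R := Real.sq_sqrt (by linarith)
  have h2 : ((k + 1 : ℕ) : ℝ) / 6 ≤ y ^ 3 := by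
    unfold growthExponent at h1
    rw [← hy, ← hy2] at h1
    have := Real.log_two_gt_d9
    nlinarith [(Nat.cast_nonneg (k + 1) : (0 : ℝ) ≤ ((k + 1 : ℕ) : ℝ))]
  have h3 : (((k + 1 : ℕ) : ℝ) / 6) ^ (4 / 3 : ℝ) ≤ 16 * R ^ 2 := by
    calc (((k + 1 : ℕ) : ℝ) / 6) ^ (4 / 3 : ℝ) ≤ (y ^ 3) ^ (4 / 3 : ℝ) := by gcongr
      _ = (y ^ 2) ^ 2 := by
        rw [← Real.rpow_natCast, ← Real.rpow_mul hy0, ← pow_mul, ← Real.rpow_natCast]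
        norm_num
      _ ≤ (4 * R) ^ 2 := by
        rw [hy2]
        gcongr
        linarith
      _ = _ := by ring
  have h4 : 0 < (((k + 1 : ℕ) : ℝ) / 6) ^ (4 / 3 : ℝ) := by positivity
  rw [← div_eq_mul_inv, le_div_iff₀ h4, inv_mul_le_iff₀ (by positivity), mul_comm]
  exact h3

theorem IsZeroEnumeration.summable (hb : IsZeroEnumeration b) :
    Summable fun n : ℤ => (‖b n‖ ^ 2)⁻¹ := by
  have h1 : Summable fun k : ℕ => (‖b (k + 1)‖ ^ 2)⁻¹ := by
    refine Summable.of_nonneg_of_le (fun _ => by positivity) hb.inv_norm_sq_le ?_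
    have h2 : Summable fun n : ℕ => 16 * (((n : ℝ) / 6) ^ (4 / 3 : ℝ))⁻¹ := by
      have h3 := (Real.summable_nat_rpow_inv (p := 4 / 3)).2 (by norm_num)
      refine (h3.mul_left (16 * 6 ^ (4 / 3 : ℝ))).congr fun n => ?_
      rw [Real.div_rpow (by positivity) (by positivity), inv_div]
      ring
    exact (summable_nat_add_iff 1).2 h2
  refine Summable.of_nat_of_neg_add_one ((summable_nat_add_iff 1).1 (by simpa using h1)) ?_
  refine h1.congr fun k => ?_
  rw [hb.conj, RCLike.norm_conj]

end Zeros

/-! ### The series of arguments and its identification with `arg Λ`. -/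

section ArgSeries

/-- Otherwise `s = r z` with `r ≥ 1` real, which contradicts `0 < Re s < Re z`. -/
theorem one_sub_div_mem_slitPlane {s z : ℂ} (hs : 0 < s.re) (hz : s.re < z.re) :
    1 - s / z ∈ Complex.slitPlane := by
  by_contra h
  rw [Complex.mem_slitPlane_iff, not_or, not_lt, ne_eq, not_not] at h
  have hz0 : z ≠ 0 := fun h0 => by
    rw [h0, Complex.zero_re] at hz
    linarith
  set r := (s / z).re with hr
  have h1 : s / z = (r : ℂ) := Complex.ext rfl (by simpa using h.2)
  have h2 : 1 ≤ r := by simpa using h.1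
  rw [div_eq_iff hz0] at h1
  have h3 := congrArg Complex.re h1
  rw [Complex.re_ofReal_mul] at h3
  nlinarith

theorem norm_log_one_sub_add_le {w : ℂ} (hw : ‖w‖ ≤ 1 / 2) :
    ‖Complex.log (1 - w) + w‖ ≤ ‖w‖ ^ 2 := by
  have h := Complex.norm_log_one_add_sub_self_le (z := -w) (by rw [norm_neg]; linarith)
  rw [norm_neg, sub_neg_eq_add, ← sub_eq_add_neg] at h
  refine h.trans ?_
  have h1 : (1 - ‖w‖)⁻¹ ≤ 2 := by
    rw [inv_le_comm₀ (by linarith) two_pos]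
    linarith
  have h2 : 0 ≤ ‖w‖ ^ 2 := by positivity
  nlinarith [mul_le_mul_of_nonneg_left h1 h2]

/-- The constant 16 also covers `‖w‖ > 1/2`, where `π + ‖w‖` is bounded crudely; no terms need to be
excluded from the majorant. -/
theorem abs_arg_one_sub_add_im_le (w : ℂ) :
    |Complex.arg (1 - w) + w.im| ≤ 16 * ‖w‖ ^ 2 := by
  rcases le_or_gt ‖w‖ (1 / 2) with hw | hw
  · have h1 : Complex.arg (1 - w) + w.im = (Complex.log (1 - w) + w).im := by
      rw [Complex.add_im, Complex.log_im]
    rw [h1]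
    refine (Complex.abs_im_le_norm _).trans ((norm_log_one_sub_add_le hw).trans ?_)
    nlinarith [sq_nonneg ‖w‖]
  · have h1 := Complex.abs_arg_le_pi (1 - w)
    have h2 := Complex.abs_im_le_norm w
    have h3 := abs_add_le (Complex.arg (1 - w)) w.im
    have h4 := Real.pi_lt_d2
    nlinarith

variable {b : ℤ → ℂ}

theorem abs_argTerm_le (b : ℤ → ℂ) (t : ℝ) (n : ℤ) :
    |argTerm b t n| ≤ 16 * ‖crit t‖ ^ 2 * (‖b n‖ ^ 2)⁻¹ := by
  refine (abs_arg_one_sub_add_im_le _).trans (le_of_eq ?_)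
  rw [norm_div]
  ring

theorem IsZeroEnumeration.mem_slitPlane (hb : IsZeroEnumeration b) (t : ℝ) (n : ℤ) :
    1 - crit t / b n ∈ Complex.slitPlane :=
  one_sub_div_mem_slitPlane (by rw [crit_re]; norm_num)
    (by rw [crit_re]; linarith [hb.one_lt_re n])

theorem IsZeroEnumeration.summable_argTerm (hb : IsZeroEnumeration b) (t : ℝ) :
    Summable (argTerm b t) :=
  Summable.of_norm_bounded (hb.summable.mul_left (16 * ‖crit t‖ ^ 2)) (abs_argTerm_le b t)

theorem IsZeroEnumeration.continuous_tsum_argTerm (hb : IsZeroEnumeration b) :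
    Continuous fun t => ∑' n, argTerm b t n := by
  have hcrit : Continuous crit := by
    unfold crit
    fun_prop
  refine continuous_iff_continuousAt.2 fun t₀ => ?_
  have hs := hb.summable.mul_left (16 * (‖crit t₀‖ + 1) ^ 2)
  have hopen : IsOpen {t | ‖crit t‖ < ‖crit t₀‖ + 1} :=
    isOpen_lt hcrit.norm continuous_const
  refine (continuousOn_tsum (fun n => ContinuousOn.mono (s := univ) ?_ (subset_univ _)) hs
    fun n t ht => ?_).continuousAt (hopen.mem_nhds (by simp))
  · refine continuousOn_univ.2 (continuous_iff_continuousAt.2 fun t => ?_)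
    refine ContinuousAt.add ?_ ?_
    · exact ContinuousAt.comp (f := fun t => 1 - crit t / b n)
        (Complex.continuousAt_arg (hb.mem_slitPlane t n))
        (continuous_const.sub (hcrit.div_const _)).continuousAt
    · exact (Complex.continuous_im.comp (hcrit.div_const _)).continuousAt
  · refine (abs_argTerm_le b t n).trans ?_
    have ht' : ‖crit t‖ ≤ ‖crit t₀‖ + 1 := le_of_lt ht
    gcongr

/-- At `t = 0` the point `s` is real, so the conjugate zeros `b n` and `b (-n)` contribute opposite
terms. -/
theorem IsZeroEnumeration.tsum_argTerm_zero (hb : IsZeroEnumeration b) :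
    ∑' n, argTerm b 0 n = 0 := by
  have h1 : ∀ n, argTerm b 0 (-n) = -argTerm b 0 n := by
    intro n
    have h2 : crit 0 / b (-n) = starRingEnd ℂ (crit 0 / b n) := by
      rw [map_div₀, ← crit_neg, neg_zero, hb.conj]
    have h3 : 1 - starRingEnd ℂ (crit 0 / b n) = starRingEnd ℂ (1 - crit 0 / b n) := by simp
    rw [argTerm, argTerm, h2, h3, Complex.arg_conj,
      if_neg (Complex.mem_slitPlane_iff_arg.1 (hb.mem_slitPlane 0 n)).1, Complex.conj_im]
    ring
  have h2 := (Equiv.neg ℤ).tsum_eq (argTerm b 0)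
  simp only [Equiv.neg_apply, h1, tsum_neg] at h2
  linarith

/-- The series of logarithms `∑ (log (1 - s / b_n) + s / b_n)` on the critical line. -/
noncomputable def logSeries (b : ℤ → ℂ) (t : ℝ) : ℂ :=
  ∑' n, (Complex.log (1 - crit t / b n) + crit t / b n)

theorem IsZeroEnumeration.hasSum_logSeries (hb : IsZeroEnumeration b) (t : ℝ) :
    HasSum (fun n => Complex.log (1 - crit t / b n) + crit t / b n) (logSeries b t) := by
  refine Summable.hasSum (Summable.of_norm_bounded_eventually
    (g := fun n => ‖crit t‖ ^ 2 * (‖b n‖ ^ 2)⁻¹) (hb.summable.mul_left _) ?_)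
  refine (finite_norm_le_of_summable hb.ne_zero hb.summable (2 * ‖crit t‖)).subset fun n hn => ?_
  by_contra hcon
  refine hn ?_
  simp only [mem_ofPred_eq, not_le] at hcon
  have h2 : ‖crit t / b n‖ ≤ 1 / 2 := by
    rw [norm_div, div_le_iff₀ (norm_pos_iff.2 (hb.ne_zero n))]
    linarith
  refine (norm_log_one_sub_add_le h2).trans (le_of_eq ?_)
  rw [norm_div]
  ring

theorem IsZeroEnumeration.logSeries_im (hb : IsZeroEnumeration b) (t : ℝ) :
    (logSeries b t).im = ∑' n, argTerm b t n := by
  refine ((Complex.hasSum_im (hb.hasSum_logSeries t)).congr_fun fun n => ?_).tsum_eq.symm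
  rw [argTerm, Complex.add_im, Complex.log_im]

theorem IsZeroEnumeration.hasProd_exp_logSeries (hb : IsZeroEnumeration b) (t : ℝ) :
    HasProd (fun n => (1 - crit t / b n) * Complex.exp (crit t / b n))
      (Complex.exp (logSeries b t)) := by
  refine (hb.hasSum_logSeries t).cexp.congr_fun fun n => ?_
  rw [Function.comp_apply, Complex.exp_add,
    Complex.exp_log (Complex.slitPlane_ne_zero (hb.mem_slitPlane t n))]

theorem IsZeroEnumeration.hasProd (hb : IsZeroEnumeration b) (s : ℂ) :
    HasProd (fun n => (1 - s / b n) * Complex.exp (s / b n))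
      (-sLam s * Complex.exp (thetaIntegral 0 * s)) :=
  hasProd_neg_sLam hb.multiplicity hb.summable s

theorem IsZeroEnumeration.Lam_eq (hb : IsZeroEnumeration b) {s : ℂ} (hs : s ≠ 0) :
    Lam s = -(Complex.exp (-(thetaIntegral 0 * s)) / s) *
      ∏' n : ℤ, (1 - s / b n) * Complex.exp (s / b n) := by
  rw [(hb.hasProd s).tprod_eq, sLam_eq hs, Complex.exp_neg]
  have := Complex.exp_ne_zero (thetaIntegral 0 * s)
  field_simp

theorem arg_crit (t : ℝ) : (crit t).arg = Real.arctan (2 * t) := by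
  have h1 := abs_lt.1 (Complex.abs_arg_lt_pi_div_two_iff.2
    (Or.inl (by rw [crit_re]; norm_num : 0 < (crit t).re)))
  have h2 := Complex.tan_arg (crit t)
  rw [crit_re, crit_im] at h2
  rw [← Real.arctan_tan h1.1 h1.2, h2]
  congr 1
  ring

theorem IsZeroEnumeration.exp_bracket (hb : IsZeroEnumeration b) {α : ℝ}
    (hα : (α : ℂ) = thetaIntegral 0) (t : ℝ) :
    Complex.exp (((bracket α b t - (Real.pi / 2 - argLam t) : ℝ) : ℂ) * Complex.I) = 1 := by
  -- `W` is a logarithm of `-Λ` read off from the product; its imaginary part is `-π/2` minus the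
  -- bracket.
  set W : ℂ := -(α * crit t) - Complex.log (crit t) + logSeries b t with hW
  have h1 : -Lam (crit t) = Complex.exp W := by
    rw [hb.Lam_eq (crit_ne_zero t), (hb.hasProd_exp_logSeries t).tprod_eq, ← hα, hW,
      Complex.exp_add, Complex.exp_sub, Complex.exp_log (crit_ne_zero t)]
    ring
  have hWim : W.im = -(α * t) - Real.arctan (2 * t) + ∑' n, argTerm b t n := by
    rw [hW, Complex.add_im, Complex.sub_im, Complex.neg_im, Complex.im_ofReal_mul, crit_im,
      Complex.log_im, arg_crit, hb.logSeries_im]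
  have h2 : bracket α b t - (Real.pi / 2 - argLam t) = argLam t - Real.pi - W.im := by
    rw [hWim, bracket]
    ring
  have h3 : ‖Lam (crit t)‖ = Real.exp W.re := by
    rw [← norm_neg, h1, Complex.norm_exp]
  have h4 := argLam_polar t
  rw [h3] at h4
  have h5 : Complex.exp W = Complex.exp (W.re : ℂ) * Complex.exp ((W.im : ℂ) * Complex.I) := by
    rw [← Complex.exp_add, Complex.re_add_im]
  have h6 : Complex.exp ((argLam t : ℂ) * Complex.I)
      = -Complex.exp ((W.im : ℂ) * Complex.I) := by
    have h7 := Complex.exp_ne_zero (W.re : ℂ)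
    refine mul_left_cancel₀ h7 ?_
    rw [Complex.ofReal_exp] at h4
    rw [← h4, mul_neg, ← h5, ← h1, neg_neg]
  rw [h2]
  push_cast
  rw [sub_mul, sub_mul, Complex.exp_sub, Complex.exp_sub, Complex.exp_pi_mul_I, h6]
  have h8 := Complex.exp_ne_zero ((W.im : ℂ) * Complex.I)
  field_simp

/-- All values lie in `2πℤ`; a nonzero one would force the value `π` or `-π` in between, where the
exponential is `-1`. -/
theorem eq_zero_of_exp_mul_I_eq_one {D : ℝ → ℝ} (hD : Continuous D) (h0 : D 0 = 0)
    (h : ∀ t, Complex.exp ((D t : ℂ) * Complex.I) = 1) (t : ℝ) : D t = 0 := by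
  have hne : ∀ x, Real.cos (D x) ≠ -1 := fun x hx => by
    have h1 := congrArg Complex.re (h x)
    rw [Complex.exp_ofReal_mul_I_re, hx, Complex.one_re] at h1
    norm_num at h1
  obtain ⟨n, hn⟩ := Complex.exp_eq_one_iff.1 (h t)
  have hDt : D t = n * (2 * Real.pi) := by simpa using congrArg Complex.im hn
  have hπ := Real.pi_pos
  rcases lt_trichotomy n 0 with hneg | hzero | hpos
  · have h1 : (n : ℝ) ≤ -1 := by exact_mod_cast Int.le_sub_one_of_lt hneg
    obtain ⟨x, hx⟩ := mem_range_of_exists_le_of_exists_ge hD (c := -Real.pi)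
      ⟨t, by rw [hDt]; nlinarith⟩ ⟨0, by rw [h0]; linarith⟩
    exact absurd (by rw [hx, Real.cos_neg, Real.cos_pi]) (hne x)
  · simp [hDt, hzero]
  · have h1 : (1 : ℝ) ≤ n := by exact_mod_cast hpos
    obtain ⟨x, hx⟩ := mem_range_of_exists_le_of_exists_ge hD (c := Real.pi)
      ⟨0, by rw [h0]; linarith⟩ ⟨t, by rw [hDt]; nlinarith⟩
    exact absurd (by rw [hx, Real.cos_pi]) (hne x)

theorem IsZeroEnumeration.bracket_eq (hb : IsZeroEnumeration b) {α : ℝ}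
    (hα : (α : ℂ) = thetaIntegral 0) (t : ℝ) :
    bracket α b t = Real.pi / 2 - argLam t := by
  have hcont : Continuous fun t => bracket α b t - (Real.pi / 2 - argLam t) := by
    unfold bracket
    refine Continuous.sub (Continuous.sub ?_ hb.continuous_tsum_argTerm)
      (continuous_const.sub continuous_argLam)
    exact (continuous_const.add (continuous_const.mul continuous_id)).add
      (Real.continuous_arctan.comp (continuous_const.mul continuous_id))
  refine sub_eq_zero.1 (eq_zero_of_exp_mul_I_eq_one hcont ?_ (hb.exp_bracket hα) t)
  simp only [bracket, hb.tsum_argTerm_zero, argLam_zero, mul_zero, Real.arctan_zero]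
  ring

end ArgSeries

end RiemannSiegelExpr

/-! ### Assembly of the theorem. -/

theorem mainTheorem1 :
    (∃ b : ℤ → ℂ, RiemannSiegelExpr.IsZeroEnumeration b) ∧
    ∃ (α : ℝ) (φ u : ℝ → ℝ),
      (α : ℂ) = RiemannSiegelExpr.thetaIntegral 0 ∧
      RiemannSiegelExpr.IsArgLam φ ∧
      (∀ t : ℝ, 0 < t → 0 < u t) ∧
      ∀ b : ℤ → ℂ, RiemannSiegelExpr.IsZeroEnumeration b →
        (∀ s : ℂ, s ≠ 0 →
          Multipliable (fun n : ℤ => (1 - s / b n) * Complex.exp (s / b n)) ∧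
          RiemannSiegelExpr.Lam s =
            -(Complex.exp (-((α : ℂ) * s)) / s) *
              ∏' n : ℤ, (1 - s / b n) * Complex.exp (s / b n)) ∧
        ∀ t : ℝ,
          (∀ n : ℤ, 1 - RiemannSiegelExpr.crit t / b n ∈ Complex.slitPlane) ∧
          Summable (RiemannSiegelExpr.argTerm b t) ∧
          RiemannSiegelExpr.Z t = ((u t * RiemannSiegelExpr.bracket α b t : ℝ) : ℂ) ∧
          RiemannSiegelExpr.bracket α b t = Real.pi / 2 - φ t := by
  have hα : (((RiemannSiegelExpr.thetaIntegral 0).re : ℝ) : ℂ)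
      = RiemannSiegelExpr.thetaIntegral 0 := by
    have h := RiemannSiegelExpr.thetaIntegral_ofReal 0
    rw [Complex.ofReal_zero] at h
    exact h.symm
  refine ⟨RiemannSiegelExpr.exists_isZeroEnumeration,
    (RiemannSiegelExpr.thetaIntegral 0).re, RiemannSiegelExpr.argLam, RiemannSiegelExpr.zFactor,
    hα, RiemannSiegelExpr.isArgLam_argLam, fun _ => RiemannSiegelExpr.zFactor_pos,
    fun b hb => ⟨fun s hs => ⟨(hb.hasProd s).multipliable, ?_⟩, fun t =>
      ⟨hb.mem_slitPlane t, hb.summable_argTerm t, ?_, hb.bracket_eq hα t⟩⟩⟩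
  · rw [hα]
    exact hb.Lam_eq hs
  · rw [hb.bracket_eq hα t]
    exact RiemannSiegelExpr.Z_eq_zFactor_mul t
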